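/- Let $\alpha,\mu,\lambda,\gamma_0,d_0,R_M>0$, $m>\max(2/\alpha,1)$, $\beta>2$, $\delta\in[2,6]$, $\kappa\in\mathbb R$, and let $B_1,\dots,B_l\in\mathbb R$, $\beta_1,\dots,\beta_l\ge 0$ be such that $$f_D(d)=\sum_{i=1}^{l}B_i\Big(\frac{d_0}{R_M}\Big)^{\beta_i+1}(d-1)^{\beta_i},\qquad 1<d<1+\frac{R_M}{d_0},$$ (and $f_D=0$ elsewhere) is a probability density, as for random-waypoint mobility in dimension 1, 2 or 3. Let $H_p^2,H_f^2,D$ be independent random variables, where $D$ has density $f_D$, $Z=H_p^2$ has density $-\frac{\beta^2}{4}\ln(z)\,z^{\beta/2-1}$ on $(0,1)$, and $X=H_f^2$ has the $\alpha$-$\mathcal F$ density $$f_X(x)=\frac{\alpha}{2\,\mathrm B(\mu,m)}A^{m}\,x^{\frac{\alpha\mu}{2}-1}\big(x^{\alpha/2}+A\big)^{-(m+\mu)},\quad x>0,\qquad A=\frac{(m-1)\,\Omega_f^{\alpha/2}}{\lambda^{\alpha/2}\mu},$$ with mean-power parameter $\Omega_f>0$, normalized by $\Omega_f\,\mathbb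 E[H_p^2]=1$ (when $\lambda$ is such that $\Omega_f=\mathbb E[H_f^2]$, this is $\mathbb E[H_p^2H_f^2]=1$). The SNR at normalized distance $d$ is $\Gamma(d)=g(d)\,H_p^2H_f^2$ with $g(d)=\gamma_0(d-1)^{-\delta}e^{-\kappa d_0d}$, and the SNR under mobility is $\Gamma=\Gamma(D)$. Put $c_1=\frac{\beta^2\alpha}{8\mathrm B(\mu,m)}c_2^{m}$, $c_2=\frac{(m-1)(\beta+2)^\alpha}{\lambda^{\alpha/2}\mu\beta^\alpha}$, $\Phi(x;a)=[a_1(x+1)]^{a_2}e^{a_3[a_1(x+1)+1]}$, $$\mathbf v_1(i)=\Big(\tfrac{R_M}{2d_0},\ \beta_i+\tfrac{\alpha\mu\delta}{2},\ \tfrac{\alpha}{2}\kappa\mu d_0\Big),\qquad \mathbf v_2=\Big(\tfrac{R_M}{2d_0},\ \tfrac{\alpha\delta}{2},\ \tfrac{\alpha}{2}\kappa d_0\Big),$$ and let $\mathcal H_f$, $\mathcal H_F$ be the Fox H-functions $$\mathcal H_f(z)=\mathrm H^{3,1}_{3,3}\!\left[z\,\middle|\,\begin{matrix}(1-\mu-m,1),(1+\beta-\alpha\mu,\alpha),(1+\beta-\alpha\mu,\alpha)\\(0,1),(\beta-\alpha\mu,\alpha),(\beta-\alpha\mu,\alpha)\end{matrix}\right],$$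 $$\mathcal H_F(z)=\mathrm H^{3,2}_{4,4}\!\left[z\,\middle|\,\begin{matrix}(1-\mu-m,1),(1-\mu,1),(1+\beta-\alpha\mu,\alpha),(1+\beta-\alpha\mu,\alpha)\\(0,1),(\beta-\alpha\mu,\alpha),(\beta-\alpha\mu,\alpha),(-\mu,1)\end{matrix}\right],$$ i.e. the integrals $\frac1{2\pi i}\int_L\Theta(s)z^{-s}\,ds$ of the corresponding Gamma quotients $\Theta$ along a vertical line $L$ separating the poles of the two families of Gamma functions in the numerator. Then: 1. For every $z>0$ a separating line exists, both integrals converge absolutely along each separating line, and their values do not depend on that line. 2. (Exactness at fixed distance.) For $1<d<1+R_M/d_0$ and $\gamma>0$, the PDF and CDF of $\Gamma(d)$ are exactly $$\frac{4c_1c_2^{-(\mu+m)}}{\Gamma(\mu+m)}\,\gamma^{\frac{\alpha\mu}2-1}g(d)^{-\frac{\alpha\mu}2}\,\mathcal H_f\Big(\tfrac{1}{c_2}\big(\tfrac{\gamma}{g(d)}\big)^{\alpha/2}\Big),\qquad \frac{8c_1c_2^{-(\mu+m)}}{\alpha\,\Gamma(\mu+m)}\Big(\frac{\gamma}{g(d)}\Big)^{\frac{\alpha\mu}{2}}\mathcal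 H_F\Big(\tfrac{1}{c_2}\big(\tfrac{\gamma}{g(d)}\big)^{\alpha/2}\Big).$$ 3. (Mobility.) For $N\in\mathbb N$ let $x_1,\dots,x_N$ be the roots of the $N$-th Legendre polynomial (it has exactly $N$ distinct real roots) and $w_1,\dots,w_N$ the corresponding Gauss–Legendre weights on $[-1,1]$, and for $\gamma>0$ put $$f_\Gamma^{(N)}(\gamma)=\frac{2R_Mc_1c_2^{-(\mu+m)}}{d_0\gamma_0\Gamma(\mu+m)}\Big(\frac{\gamma}{\gamma_0}\Big)^{\frac{\alpha\mu}2-1}\sum_{i=1}^{l}\sum_{k=1}^{N}B_i\Big(\frac{d_0}{R_M}\Big)^{\beta_i+1}w_k\,\Phi(x_k;\mathbf v_1(i))\,\mathcal H_f\Big(\tfrac{\Phi(x_k;\mathbf v_2)}{c_2}\big(\tfrac{\gamma}{\gamma_0}\big)^{\alpha/2}\Big),$$ $$F_\Gamma^{(N)}(\gamma)=\frac{4R_Mc_1c_2^{-(\mu+m)}}{\alpha d_0\Gamma(\mu+m)}\Big(\frac{\gamma}{\gamma_0}\Big)^{\frac{\alpha\mu}2}\sum_{i=1}^{l}\sum_{k=1}^{N}B_i\Big(\frac{d_0}{R_M}\Big)^{\beta_i+1}w_k\,\Phi(x_k;\mathbf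 v_1(i))\,\mathcal H_F\Big(\tfrac{\Phi(x_k;\mathbf v_2)}{c_2}\big(\tfrac{\gamma}{\gamma_0}\big)^{\alpha/2}\Big).$$ Then the PDF $f_\Gamma$ (supported on $(0,\infty)$) and the CDF $F_\Gamma$ of $\Gamma$ are given, for every $\gamma>0$, exactly by the same expressions with each quadrature sum $\sum_{k=1}^N w_k(\cdots)(x_k)$ replaced by the (convergent) integral $\int_{-1}^1(\cdots)(x)\,dx$ over the rescaled distance $x=2d_0(d-1)/R_M-1$; and the double sums, which are the $N$-point Gauss–Legendre approximations of these integrals, satisfy $f_\Gamma^{(N)}(\gamma)\to f_\Gamma(\gamma)$ and $F_\Gamma^{(N)}(\gamma)\to F_\Gamma(\gamma)$ as $N\to\infty$. -/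

import Mathlib

open MeasureTheory ProbabilityTheory Filter Topology

noncomputable section

/-! ### The Fox H-function

`H^{m,n}_{p,q}[z | (a₁,A₁),…,(a_p,A_p) ; (b₁,B₁),…,(b_q,B_q)]` is the Mellin–Barnes integral
`(1 / 2πi) ∫_L Θ(s) z^{-s} ds` along a line `L = {Re s = c}` from `c - i∞` to `c + i∞` which has the
poles of `Γ(b_j + B_j s)`, `j ≤ m`, on its left and those of `Γ(1 - a_j - A_j s)`, `j ≤ n`, on its
right. The lists are indexed by `Fin p`, `Fin q`; an entry of `a` is the pair `(a_j, A_j)`. -/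

/-- The Mellin–Barnes kernel `Θ(s)`. The functions in the denominator enter as `1 / Γ`
(which is entire; at a pole of `Γ` the expression below has the correct value `0`). -/
def foxKernel (m n : ℕ) {p q : ℕ} (a : Fin p → ℝ × ℝ) (b : Fin q → ℝ × ℝ) (s : ℂ) : ℂ :=
  (∏ j : Fin q, if (j : ℕ) < m then Complex.Gamma ((b j).1 + (b j).2 * s)
      else (Complex.Gamma (1 - (b j).1 - (b j).2 * s))⁻¹) *
  (∏ j : Fin p, if (j : ℕ) < n then Complex.Gamma (1 - (a j).1 - (a j).2 * s)
      else (Complex.Gamma ((a j).1 + (a j).2 * s))⁻¹)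

/-- The line `Re s = c` separates the two families of poles: `-(b_j + k) / B_j` for `j ≤ m` lie on
its left, `(1 - a_j + k) / A_j` for `j ≤ n` lie on its right (`k = 0, 1, 2, …`). -/
def FoxSeparates (m n : ℕ) {p q : ℕ} (a : Fin p → ℝ × ℝ) (b : Fin q → ℝ × ℝ) (c : ℝ) : Prop :=
  (∀ j : Fin q, (j : ℕ) < m → ∀ k : ℕ, -((b j).1 + k) / (b j).2 < c) ∧
  (∀ j : Fin p, (j : ℕ) < n → ∀ k : ℕ, c < (1 - (a j).1 + k) / (a j).2)

/-- The integrand `t ↦ Θ(c + it) z^{-(c + it)}` on the line `Re s = c`. -/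
def foxIntegrand (m n : ℕ) {p q : ℕ} (a : Fin p → ℝ × ℝ) (b : Fin q → ℝ × ℝ) (z c t : ℝ) : ℂ :=
  foxKernel m n a b (c + t * Complex.I) * (z : ℂ) ^ (-((c : ℂ) + t * Complex.I))

/-- `H^{m,n}_{p,q}[z | a ; b]` is well defined with value `h`: there is a separating line, and along
every separating line the Mellin–Barnes integral converges absolutely and has the value `h`. -/
def HasFoxH (m n : ℕ) {p q : ℕ} (a : Fin p → ℝ × ℝ) (b : Fin q → ℝ × ℝ) (z : ℝ) (h : ℂ) : Prop :=
  (∃ c : ℝ, FoxSeparates m n a b c) ∧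
  ∀ c : ℝ, FoxSeparates m n a b c →
    Integrable (foxIntegrand m n a b z c) ∧
    (1 / (2 * Real.pi) : ℂ) * ∫ t : ℝ, foxIntegrand m n a b z c t = h

open Classical in
/-- The Fox H-function (with value `0` where it is not well defined). -/
def foxH (m n : ℕ) {p q : ℕ} (a : Fin p → ℝ × ℝ) (b : Fin q → ℝ × ℝ) (z : ℝ) : ℂ :=
  if h : ∃ v : ℂ, HasFoxH m n a b z v then h.choose else 0

/-! ### Gauss–Legendre quadrature on `[-1, 1]` -/

/-- The Legendre polynomial `P_N = (1 / (2^N N!)) (d/dx)^N (x² - 1)^N`. -/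
def legendrePoly (N : ℕ) : Polynomial ℝ :=
  Polynomial.C (1 / (2 ^ N * (N.factorial : ℝ))) *
    Polynomial.derivative^[N] ((Polynomial.X ^ 2 - 1) ^ N)

/-- The nodes: the real roots of `P_N`. -/
def glNodes (N : ℕ) : Finset ℝ := (legendrePoly N).roots.toFinset

/-- The weight of the node `x`: the integral over `[-1, 1]` of the Lagrange basis polynomial at
`x` for the set of nodes. -/
def glWeight (N : ℕ) (x : ℝ) : ℝ :=
  ∫ t in (-1 : ℝ)..1, (Lagrange.basis (glNodes N) id x).eval t

/-! ### The link -/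

/-- The parameters: fading (`α`, `μ`, `m`, `lam`), beam misalignment `β`, path-loss exponent `δ`,
reference SNR `γ₀`, absorption coefficient `κ` at the carrier frequency, reference distance `d₀`,
largest separation `RM`, and the coefficients `Bᵢ` and exponents `bᵢ` of the random-waypoint
density. -/
structure LinkParams where
  α : ℝ
  μ : ℝ
  m : ℝ
  lam : ℝ
  β : ℝ
  δ : ℝ
  γ₀ : ℝ
  κ : ℝ
  d₀ : ℝ
  RM : ℝ
  l : ℕ
  B : Fin l → ℝ
  b : Fin l → ℝ

namespace LinkParams

variable (S : LinkParams)

/-- Density of the power `Z = H_p²` of the pointing error. -/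
def misalignPDF (z : ℝ) : ℝ :=
  if 0 < z ∧ z < 1 then -(S.β ^ 2 / 4) * Real.log z * z ^ (S.β / 2 - 1) else 0

/-- Density of the power `X = H_f²` of the `α`-`F` fading with mean-power parameter `Ef`. -/
def fadingPDF (Ef x : ℝ) : ℝ :=
  if 0 < x then
    S.α / (2 * beta S.μ S.m) *
      ((S.m - 1) * Ef ^ (S.α / 2) / (S.lam ^ (S.α / 2) * S.μ)) ^ S.m *
      x ^ (S.α * S.μ / 2 - 1) *
      (x ^ (S.α / 2) + (S.m - 1) * Ef ^ (S.α / 2) / (S.lam ^ (S.α / 2) * S.μ)) ^ (-(S.m + S.μ))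
  else 0

/-- Random-waypoint density of the normalized distance `D = (R_t + d₀) / d₀`. -/
def distPDF (d : ℝ) : ℝ :=
  if 1 < d ∧ d < 1 + S.RM / S.d₀ then
    ∑ i, S.B i * (S.d₀ / S.RM) ^ (S.b i + 1) * (d - 1) ^ S.b i
  else 0

/-- The SNR at normalized distance `d` for the pointing error `hp` and the fading envelope `hf`. -/
def snr (d hp hf : ℝ) : ℝ :=
  S.γ₀ * (d - 1) ^ (-S.δ) * Real.exp (-S.κ * S.d₀ * d) * hp ^ 2 * hf ^ 2

def c₁ : ℝ :=
  S.β ^ 2 * S.α / (8 * beta S.μ S.m) *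
    ((S.m - 1) * (S.β + 2) ^ S.α / (S.β ^ S.α * S.lam ^ (S.α / 2) * S.μ)) ^ S.m

def c₂ : ℝ :=
  (S.m - 1) * (S.β + 2) ^ S.α / (S.lam ^ (S.α / 2) * S.μ * S.β ^ S.α)

/-- `Φ(x; a) = [a₁ (x + 1)]^{a₂} exp(a₃ [a₁ (x + 1) + 1])`. -/
def Phi (x : ℝ) (a : Fin 3 → ℝ) : ℝ :=
  (a 0 * (x + 1)) ^ a 1 * Real.exp (a 2 * (a 0 * (x + 1) + 1))

def v₁ (i : Fin S.l) : Fin 3 → ℝ :=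
  ![S.RM / (2 * S.d₀), S.b i + S.α * S.μ * S.δ / 2, S.α / 2 * S.κ * S.μ * S.d₀]

def v₂ : Fin 3 → ℝ :=
  ![S.RM / (2 * S.d₀), S.α * S.δ / 2, S.α / 2 * S.κ * S.d₀]

/-- Upper and lower parameters of the function `H^{3,1}_{3,3}` in the PDF. -/
def pdfTop : Fin 3 → ℝ × ℝ :=
  ![(1 - S.μ - S.m, 1), (1 + S.β - S.α * S.μ, S.α), (1 + S.β - S.α * S.μ, S.α)]

def pdfBot : Fin 3 → ℝ × ℝ :=
  ![(0, 1), (S.β - S.α * S.μ, S.α), (S.β - S.α * S.μ, S.α)]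

/-- Upper and lower parameters of the function `H^{3,2}_{4,4}` in the CDF. -/
def cdfTop : Fin 4 → ℝ × ℝ :=
  ![(1 - S.μ - S.m, 1), (1 - S.μ, 1), (1 + S.β - S.α * S.μ, S.α), (1 + S.β - S.α * S.μ, S.α)]

def cdfBot : Fin 4 → ℝ × ℝ :=
  ![(0, 1), (S.β - S.α * S.μ, S.α), (S.β - S.α * S.μ, S.α), (-S.μ, 1)]

/-- `H^{3,1}_{3,3}` of the PDF as a function of its argument. -/
def pdfH (z : ℝ) : ℂ := foxH 3 1 S.pdfTop S.pdfBot z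

/-- `H^{3,2}_{4,4}` of the CDF as a function of its argument. -/
def cdfH (z : ℝ) : ℂ := foxH 3 2 S.cdfTop S.cdfBot z

/-! Statistics at a fixed distance `d`; `gain d` is the factor in front of `H_p² H_f²`. -/

def gain (d : ℝ) : ℝ := S.γ₀ * (d - 1) ^ (-S.δ) * Real.exp (-S.κ * S.d₀ * d)

def condPDF (d γ : ℝ) : ℂ :=
  ((4 * S.c₁ * S.c₂ ^ (-(S.μ + S.m)) / Real.Gamma (S.μ + S.m) * γ ^ (S.α * S.μ / 2 - 1) *
      S.gain d ^ (-(S.α * S.μ / 2)) : ℝ) : ℂ) *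
    S.pdfH ((γ / S.gain d) ^ (S.α / 2) / S.c₂)

def condCDF (d γ : ℝ) : ℂ :=
  ((8 * S.c₁ * S.c₂ ^ (-(S.μ + S.m)) / (S.α * Real.Gamma (S.μ + S.m)) *
      (γ / S.gain d) ^ (S.α * S.μ / 2) : ℝ) : ℂ) *
    S.cdfH ((γ / S.gain d) ^ (S.α / 2) / S.c₂)

/-! Statistics under mobility. -/

/-- The factor in front of the double sum of the PDF. -/
def pdfFactor (γ : ℝ) : ℝ :=
  2 * S.RM * S.c₁ * S.c₂ ^ (-(S.μ + S.m)) / (S.d₀ * S.γ₀ * Real.Gamma (S.μ + S.m)) *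
    (γ / S.γ₀) ^ (S.α * S.μ / 2 - 1)

/-- The factor in front of the double sum of the CDF. -/
def cdfFactor (γ : ℝ) : ℝ :=
  4 * S.RM * S.c₁ * S.c₂ ^ (-(S.μ + S.m)) / (S.α * S.d₀ * Real.Gamma (S.μ + S.m)) *
    (γ / S.γ₀) ^ (S.α * S.μ / 2)

/-- The function of the rescaled distance variable `x = 2 d₀ (d - 1) / RM - 1 ∈ [-1, 1]` which is
evaluated at the quadrature nodes in the `i`-th part of the PDF. -/
def pdfTerm (i : Fin S.l) (γ x : ℝ) : ℂ :=
  (Phi x (S.v₁ i) : ℂ) * S.pdfH (Phi x S.v₂ / S.c₂ * (γ / S.γ₀) ^ (S.α / 2))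

/-- The same for the CDF. -/
def cdfTerm (i : Fin S.l) (γ x : ℝ) : ℂ :=
  (Phi x (S.v₁ i) : ℂ) * S.cdfH (Phi x S.v₂ / S.c₂ * (γ / S.γ₀) ^ (S.α / 2))

/-- The double sum of functions `H^{3,1}_{3,3}` for the PDF. -/
def pdfSum (N : ℕ) (γ : ℝ) : ℂ :=
  (S.pdfFactor γ : ℂ) * ∑ i, ∑ x ∈ glNodes N,
    ((S.B i * (S.d₀ / S.RM) ^ (S.b i + 1) * glWeight N x : ℝ) : ℂ) * S.pdfTerm i γ x

/-- The double sum of functions `H^{3,2}_{4,4}` for the CDF. -/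
def cdfSum (N : ℕ) (γ : ℝ) : ℂ :=
  (S.cdfFactor γ : ℂ) * ∑ i, ∑ x ∈ glNodes N,
    ((S.B i * (S.d₀ / S.RM) ^ (S.b i + 1) * glWeight N x : ℝ) : ℂ) * S.cdfTerm i γ x

/-- The expression of which `pdfSum N` is the `N`-point quadrature. -/
def pdfIntegral (γ : ℝ) : ℂ :=
  (S.pdfFactor γ : ℂ) * ∑ i, ((S.B i * (S.d₀ / S.RM) ^ (S.b i + 1) : ℝ) : ℂ) *
    ∫ x in (-1 : ℝ)..1, S.pdfTerm i γ x

/-- The expression of which `cdfSum N` is the `N`-point quadrature. -/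
def cdfIntegral (γ : ℝ) : ℂ :=
  (S.cdfFactor γ : ℂ) * ∑ i, ((S.B i * (S.d₀ / S.RM) ^ (S.b i + 1) : ℝ) : ℂ) *
    ∫ x in (-1 : ℝ)..1, S.cdfTerm i γ x

end LinkParams

/-- The law `ν` has a PDF which vanishes on `(-∞, 0]` and is given by `F` at every point of
`(0, ∞)`; in particular `F` takes nonnegative real values there. -/
def HasPDFOnPos (ν : Measure ℝ) (F : ℝ → ℂ) : Prop :=
  ∃ f : ℝ → ℝ, Measurable f ∧ (∀ γ, 0 ≤ f γ) ∧ (∀ γ ≤ 0, f γ = 0) ∧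
    ν = volume.withDensity (fun γ => ENNReal.ofReal (f γ)) ∧
    ∀ γ > 0, (f γ : ℂ) = F γ

end

/-!
The two Fox functions are inverse Mellin transforms of elementary averages. On a separating line the
kernels reduce to `Γ(s) Γ(M - s) / (ν + α s)²` and to the same expression divided by `μ - s`, where
`M = μ + m` and `ν = β - α μ`, because `Γ(w) / Γ(w + 1) = 1 / w` (`foxKernel_pdf`, `foxKernel_cdf`).
Averaging the dilates `K(φ(u) y)` of a function `K` against a weight multiplies its Mellin transform
by that of the weight (`hasMellin_dilationMix`). Starting from `exp (-y)`, three such averages produce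
in turn `Γ(s) Γ(M - s)`, the factor `1 / (ν + α s)²` (weight `-log z` times a power of `z`, as in the
density of the misalignment power) and the factor `1 / (μ - s)` (a power weight). The resulting real
functions `fadingMix` and `fadingMixCDF` are continuous on `(0, ∞)` and their transforms are
integrable on vertical lines, so that Mellin inversion identifies them with the Mellin–Barnes
integrals on every separating line at once; no contour has to be moved.

The same averages are what probability produces. The density of `g Z X` is the multiplicative
convolution of the densities of `Z` and `X`, which is `fadingMix` up to a power and a constant
(`lintegral_misalignPDF_mul_fadingPDF`); the normalization enters through the mean `β² / (β + 2)²`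
of `Z`, which turns the scale of the fading density into `c₂`. Integrating the density over
`(0, γ]` and substituting `γ v` gives `fadingMixCDF` (`lintegral_Iic_scaledPDF`). Mobility is an
additional average over the distance, exchanged with the other ones by Tonelli's theorem and written
in the variable `x ∈ [-1, 1]` (`lintegral_distPDF_mul`).

For the quadrature, the distance integrand is continuous on the whole of `[-1, 1]`: near `x = -1` the
bound `O(y^{-c})` for the Fox functions, with `c < μ`, is outweighed by the vanishing factor `Φ`
(`continuousOn_Phi_mul`). Gauss–Legendre quadrature converges for continuous functions
(`tendsto_glQuadrature`), since it is exact on polynomials of degree less than `2 N` and has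
nonnegative weights of total mass `2`. The Legendre polynomial has `N` distinct real roots by Rolle's
theorem, and these lie in `[-1, 1]` by the Gauss–Lucas theorem.
-/

/-! ### Legendre polynomials: roots and orthogonality -/

section GaussLegendre

open Polynomial

lemma eval_iterate_derivative_sq_sub_one_pow {N j : ℕ} (hj : j < N) {x : ℝ} (hx : x ^ 2 = 1) :
    (derivative^[j] ((X ^ 2 - 1 : ℝ[X]) ^ N)).eval x = 0 := by
  obtain ⟨q, hq⟩ := pow_sub_dvd_iterate_derivative_pow (X ^ 2 - 1 : ℝ[X]) N j
  rw [hq]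
  simp [hx, Nat.sub_ne_zero_of_lt hj]

/-- By Rolle's theorem each derivative has a root strictly between consecutive roots of the previous
one, and as long as `j < N` the two endpoints `±1` remain roots. -/
lemma add_two_le_card_roots_iterate_derivative {N j : ℕ} (hj : j < N) :
    j + 2 ≤ (derivative^[j] ((X ^ 2 - 1 : ℝ[X]) ^ N)).roots.toFinset.card := by
  have hpm : ∀ j < N, derivative^[j] ((X ^ 2 - 1 : ℝ[X]) ^ N) ≠ 0 →
      ({1, -1} : Finset ℝ) ⊆ (derivative^[j] ((X ^ 2 - 1 : ℝ[X]) ^ N)).roots.toFinset := by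
    intro j hj h0 x hx
    rw [Multiset.mem_toFinset, mem_roots h0, IsRoot]
    apply eval_iterate_derivative_sq_sub_one_pow hj
    simp only [Finset.mem_insert, Finset.mem_singleton] at hx
    rcases hx with rfl | rfl <;> norm_num
  have hc : ({1, -1} : Finset ℝ).card = 2 := by
    rw [Finset.card_pair]; norm_num
  induction j with
  | zero =>
    have h0 : ((X ^ 2 - 1 : ℝ[X]) ^ N) ≠ 0 := by
      apply pow_ne_zero
      intro h
      have := congrArg (eval 0) h
      norm_num at this
    calc 0 + 2 = ({1, -1} : Finset ℝ).card := by rw [hc]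
      _ ≤ _ := Finset.card_le_card (hpm 0 hj h0)
  | succ j ih =>
    have ih := ih (by omega)
    have hR := card_roots_toFinset_le_card_roots_derivative_sdiff_roots_succ
      (derivative^[j] ((X ^ 2 - 1 : ℝ[X]) ^ N))
    rw [← Function.iterate_succ_apply' derivative] at hR
    set p := derivative^[j] ((X ^ 2 - 1 : ℝ[X]) ^ N) with hp
    set q := derivative^[j + 1] ((X ^ 2 - 1 : ℝ[X]) ^ N) with hq
    have hq0 : q ≠ 0 := by
      intro h
      simp [h] at hR
      omega
    have hp0 : p ≠ 0 := by
      intro h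
      simp [h] at ih
    have hdisj : Disjoint ({1, -1} : Finset ℝ) (q.roots.toFinset \ p.roots.toFinset) :=
      Finset.disjoint_sdiff.mono_left (hpm j (by omega) hp0)
    have hsub : ({1, -1} : Finset ℝ) ∪ (q.roots.toFinset \ p.roots.toFinset) ⊆
        q.roots.toFinset :=
      Finset.union_subset (hpm (j + 1) hj hq0) Finset.sdiff_subset
    have := Finset.card_le_card hsub
    rw [Finset.card_union_of_disjoint hdisj, hc] at this
    omega

lemma natDegree_legendrePoly_le (N : ℕ) : (legendrePoly N).natDegree ≤ N := by
  unfold legendrePoly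
  refine (natDegree_C_mul_le _ _).trans ((natDegree_iterate_derivative _ _).trans ?_)
  have h1 : (X ^ 2 - 1 : ℝ[X]).natDegree = 2 := by
    simpa using natDegree_X_pow_sub_C (R := ℝ) (n := 2) (r := 1)
  rw [natDegree_pow, h1]
  omega

lemma le_card_glNodes (N : ℕ) : N ≤ (glNodes N).card := by
  cases N with
  | zero => simp
  | succ n =>
    have h1 := add_two_le_card_roots_iterate_derivative (Nat.lt_succ_self n)
    have hR := card_roots_toFinset_le_derivative
      (derivative^[n] ((X ^ 2 - 1 : ℝ[X]) ^ (n + 1)))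
    rw [← Function.iterate_succ_apply' derivative] at hR
    unfold glNodes legendrePoly
    rw [roots_C_mul _ (by positivity)]
    simp only [Nat.succ_eq_add_one] at *
    omega

/-- Rolle's theorem gives at least `N` distinct roots, the degree at most `N`. -/
lemma card_glNodes (N : ℕ) : (glNodes N).card = N :=
  le_antisymm ((Multiset.toFinset_card_le _).trans
    ((card_roots' _).trans (natDegree_legendrePoly_le N))) (le_card_glNodes N)

lemma legendrePoly_ne_zero (N : ℕ) : legendrePoly N ≠ 0 := by
  cases N with
  | zero => simp [legendrePoly]
  | succ n =>
    intro h
    have := le_card_glNodes (n + 1)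
    simp [glNodes, h] at this

lemma degree_legendrePoly (N : ℕ) : (legendrePoly N).degree = N := by
  refine le_antisymm (degree_le_of_natDegree_le (natDegree_legendrePoly_le N)) ?_
  rw [degree_eq_natDegree (legendrePoly_ne_zero N)]
  exact_mod_cast (le_card_glNodes N).trans ((Multiset.toFinset_card_le _).trans (card_roots' _))

/-- By the Gauss–Lucas theorem, the complex roots of the derivatives of `(X² - 1)^N` stay in the
closed unit disc, which is convex. -/
lemma rootSet_iterate_derivative_subset (N j : ℕ) :
    (derivative^[j] ((X ^ 2 - 1 : ℂ[X]) ^ N)).rootSet ℂ ⊆ Metric.closedBall 0 1 := by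
  induction j with
  | zero =>
    intro z hz
    have := (mem_rootSet.1 hz).2
    simp only [Function.iterate_zero, id_eq, map_pow, map_sub, map_one, aeval_X] at this
    have h2 : z ^ 2 = 1 := sub_eq_zero.1 (eq_zero_of_pow_eq_zero this)
    have h3 : ‖z‖ ^ 2 = 1 := by rw [← norm_pow, h2, norm_one]
    rw [mem_closedBall_zero_iff]
    nlinarith [norm_nonneg z]
  | succ j ih =>
    rw [Function.iterate_succ_apply']
    rcases le_or_gt (degree (derivative^[j] ((X ^ 2 - 1 : ℂ[X]) ^ N))) 0 with h | h
    · rw [eq_C_of_degree_le_zero h]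
      simp
    · exact (rootSet_derivative_subset_convexHull_rootSet h).trans
        (convexHull_min ih (convex_closedBall 0 1))

lemma glNodes_subset_Icc {N : ℕ} {x : ℝ} (hx : x ∈ glNodes N) : x ∈ Set.Icc (-1 : ℝ) 1 := by
  have h0 := legendrePoly_ne_zero N
  rw [glNodes, Multiset.mem_toFinset, mem_roots h0, IsRoot] at hx
  have hr : (derivative^[N] ((X ^ 2 - 1 : ℝ[X]) ^ N)).eval x = 0 := by
    simpa [legendrePoly, Nat.factorial_ne_zero] using hx
  have hd0 : derivative^[N] ((X ^ 2 - 1 : ℝ[X]) ^ N) ≠ 0 := by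
    intro h
    exact h0 (by simp [legendrePoly, h])
  have hmap : derivative^[N] ((X ^ 2 - 1 : ℂ[X]) ^ N) =
      (derivative^[N] ((X ^ 2 - 1 : ℝ[X]) ^ N)).map Complex.ofRealHom := by
    rw [← iterate_derivative_map]; simp
  have hmem : (x : ℂ) ∈ (derivative^[N] ((X ^ 2 - 1 : ℂ[X]) ^ N)).rootSet ℂ := by
    rw [mem_rootSet]
    constructor
    · rw [hmap]
      exact (Polynomial.map_ne_zero_iff Complex.ofReal_injective).2 hd0
    · rw [hmap, coe_aeval_eq_eval, eval_map]
      have := eval₂_hom (p := derivative^[N] ((X ^ 2 - 1 : ℝ[X]) ^ N)) Complex.ofRealHom x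
      rw [hr] at this
      simpa using this
  have := rootSet_iterate_derivative_subset N N hmem
  rw [mem_closedBall_zero_iff, Complex.norm_real, Real.norm_eq_abs] at this
  exact abs_le.1 this

lemma intervalIntegrable_eval (p : ℝ[X]) (a b : ℝ) :
    IntervalIntegrable (fun x => p.eval x) volume a b :=
  p.continuous.intervalIntegrable a b

/-- Repeated integration by parts: the boundary terms vanish at `±1`. -/
lemma integral_iterate_derivative_mul_eq_zero {N k : ℕ} (hk : k ≤ N) (q : ℝ[X])
    (hq : q.degree < k) :
    ∫ x in (-1 : ℝ)..1, (derivative^[k] ((X ^ 2 - 1 : ℝ[X]) ^ N)).eval x * q.eval x = 0 := by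
  induction k generalizing q with
  | zero =>
    have : q = 0 := by
      rw [← degree_eq_bot]
      simpa using hq
    simp [this]
  | succ k ih =>
    have hparts := intervalIntegral.integral_mul_deriv_eq_deriv_mul (a := -1) (b := 1)
      (u := fun x => q.eval x) (u' := fun x => (derivative q).eval x)
      (v := fun x => (derivative^[k] ((X ^ 2 - 1 : ℝ[X]) ^ N)).eval x)
      (v' := fun x => (derivative^[k + 1] ((X ^ 2 - 1 : ℝ[X]) ^ N)).eval x)
      (fun x _ => q.hasDerivAt x)
      (fun x _ => by
        rw [Function.iterate_succ_apply' derivative]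
        exact Polynomial.hasDerivAt _ x)
      (intervalIntegrable_eval _ _ _) (intervalIntegrable_eval _ _ _)
    rw [eval_iterate_derivative_sq_sub_one_pow (by omega) (by norm_num : (1 : ℝ) ^ 2 = 1),
      eval_iterate_derivative_sq_sub_one_pow (by omega) (by norm_num : (-1 : ℝ) ^ 2 = 1)] at hparts
    have hq' : (derivative q).degree < k := by
      by_cases h0 : q = 0
      · simp [h0]
      · by_cases hd : derivative q = 0
        · simp [hd]
        · rw [degree_eq_natDegree hd]
          have h1 := degree_derivative_lt h0
          rw [degree_eq_natDegree hd, degree_eq_natDegree h0] at h1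
          rw [degree_eq_natDegree h0] at hq
          norm_cast at h1 hq ⊢
          omega
    have h2 := ih (by omega) (derivative q) hq'
    calc _ = ∫ x in (-1 : ℝ)..1, q.eval x *
          (derivative^[k + 1] ((X ^ 2 - 1 : ℝ[X]) ^ N)).eval x := by simp only [mul_comm]
      _ = 0 := by
        simp only [mul_comm] at h2 hparts ⊢
        rw [hparts, h2]
        ring

lemma integral_legendrePoly_mul_eq_zero {N : ℕ} (q : ℝ[X]) (hq : q.degree < N) :
    ∫ x in (-1 : ℝ)..1, (legendrePoly N * q).eval x = 0 := by
  simp only [legendrePoly, eval_mul, eval_C, mul_assoc]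
  rw [intervalIntegral.integral_const_mul, integral_iterate_derivative_mul_eq_zero le_rfl q hq,
    mul_zero]

/-! ### Gauss–Legendre quadrature -/

lemma sum_glWeight_mul_eval_of_degree_lt {N : ℕ} (q : ℝ[X]) (hq : q.degree < N) :
    ∑ x ∈ glNodes N, glWeight N x * q.eval x = ∫ x in (-1 : ℝ)..1, q.eval x := by
  have hI : q = Lagrange.interpolate (glNodes N) id (fun x => q.eval x) :=
    Lagrange.eq_interpolate (s := glNodes N) (v := id) (f := q) (Set.injOn_id _)
      (by rwa [card_glNodes])
  calc ∑ x ∈ glNodes N, glWeight N x * q.eval x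
      = ∑ x ∈ glNodes N, ∫ t in (-1 : ℝ)..1,
          (Lagrange.basis (glNodes N) id x).eval t * q.eval x := by
        simp only [glWeight, intervalIntegral.integral_mul_const]
    _ = ∫ t in (-1 : ℝ)..1, ∑ x ∈ glNodes N,
          (Lagrange.basis (glNodes N) id x).eval t * q.eval x := by
        rw [intervalIntegral.integral_finsetSum]
        intro x _
        exact (intervalIntegrable_eval _ _ _).mul_const _
    _ = ∫ t in (-1 : ℝ)..1, q.eval t := by
        congr 1 with t
        conv_rhs => rw [hI]
        simp [Lagrange.interpolate_apply, eval_finsetSum, mul_comm]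

/-- The quadrature with `N` nodes is exact up to degree `2 N - 1`: divide by `P_N`. -/
lemma sum_glWeight_mul_eval {N : ℕ} (q : ℝ[X]) (hq : q.degree < (2 * N : ℕ)) :
    ∑ x ∈ glNodes N, glWeight N x * q.eval x = ∫ x in (-1 : ℝ)..1, q.eval x := by
  have hP := legendrePoly_ne_zero N
  have hdm := EuclideanDomain.mod_add_div q (legendrePoly N)
  set r := q % legendrePoly N
  set a := q / legendrePoly N
  have hr : r.degree < N := by
    rw [← degree_legendrePoly N]
    exact EuclideanDomain.mod_lt q hP
  have ha : a.degree < N := by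
    by_contra h
    push Not at h
    have hle : ((2 * N : ℕ) : WithBot ℕ) ≤ (legendrePoly N * a).degree := by
      rw [degree_mul, degree_legendrePoly]
      calc ((2 * N : ℕ) : WithBot ℕ) = N + N := by push_cast; ring
        _ ≤ _ := by gcongr
    have h1 : r.degree < (legendrePoly N * a).degree := by
      refine (hr.trans_le ?_).trans_le hle
      exact_mod_cast (by omega : N ≤ 2 * N)
    have := degree_add_eq_right_of_degree_lt h1
    rw [hdm] at this
    exact absurd hq (not_lt.2 (this ▸ hle))
  rw [← hdm]
  calc ∑ x ∈ glNodes N, glWeight N x * (r + legendrePoly N * a).eval x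
      = ∑ x ∈ glNodes N, glWeight N x * r.eval x := by
        refine Finset.sum_congr rfl fun x hx => ?_
        rw [glNodes, Multiset.mem_toFinset, mem_roots hP, IsRoot] at hx
        simp [hx]
    _ = ∫ x in (-1 : ℝ)..1, r.eval x := sum_glWeight_mul_eval_of_degree_lt r hr
    _ = ∫ x in (-1 : ℝ)..1, (r + legendrePoly N * a).eval x := by
        simp only [eval_add]
        rw [intervalIntegral.integral_add (intervalIntegrable_eval _ _ _)
          (intervalIntegrable_eval _ _ _), integral_legendrePoly_mul_eq_zero a ha, add_zero]

/-- The weights are nonnegative, being the integrals of the squares of the Lagrange basis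
polynomials, whose degree is `2 N - 2`. -/
lemma glWeight_nonneg {N : ℕ} {x : ℝ} (hx : x ∈ glNodes N) : 0 ≤ glWeight N x := by
  set L := Lagrange.basis (glNodes N) id x
  have hdeg : (L ^ 2).degree < (2 * N : ℕ) := by
    have hL : L.natDegree = N - 1 := by
      rw [Lagrange.natDegree_basis (Set.injOn_id _) hx, card_glNodes]
    have hN : 0 < N := by
      rw [← card_glNodes N]
      exact Finset.card_pos.2 ⟨x, hx⟩
    refine (degree_le_natDegree).trans_lt ?_
    rw [natDegree_pow, hL]
    exact_mod_cast (by omega : 2 * (N - 1) < 2 * N)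
  have h := sum_glWeight_mul_eval (N := N) (L ^ 2) hdeg
  have hsum : ∑ y ∈ glNodes N, glWeight N y * (L ^ 2).eval y = glWeight N x := by
    rw [Finset.sum_eq_single x]
    · have : L.eval (id x) = 1 := Lagrange.eval_basis_self (Set.injOn_id _) hx
      simp only [id_eq] at this
      simp [this]
    · intro y hy hyx
      have : L.eval (id y) = 0 := Lagrange.eval_basis_of_ne hyx.symm hy
      simp only [id_eq] at this
      simp [this]
    · exact fun h => absurd hx h
  rw [← hsum, h]
  refine intervalIntegral.integral_nonneg (by norm_num) fun t _ => ?_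
  rw [eval_pow]
  positivity

lemma sum_glWeight {N : ℕ} (hN : 0 < N) : ∑ x ∈ glNodes N, glWeight N x = 2 := by
  have := sum_glWeight_mul_eval (N := N) 1 (by
    rw [degree_one]; exact_mod_cast (by omega : 0 < 2 * N))
  simp only [eval_one, mul_one] at this
  rw [this]
  norm_num

/-- Convergence of Gauss–Legendre quadrature for continuous functions: approximate by a polynomial
(Weierstrass), for which the quadrature is eventually exact; the weights have total mass `2`. -/
theorem tendsto_glQuadrature {f : ℝ → ℝ} (hf : ContinuousOn f (Set.Icc (-1) 1)) :
    Tendsto (fun N => ∑ x ∈ glNodes N, glWeight N x * f x) atTop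
      (𝓝 (∫ x in (-1 : ℝ)..1, f x)) := by
  rw [Metric.tendsto_atTop]
  intro ε hε
  obtain ⟨p, hp⟩ := exists_polynomial_near_of_continuousOn (-1) 1 f hf (ε / 5) (by positivity)
  refine ⟨p.natDegree + 1, fun N hN => ?_⟩
  have hex := sum_glWeight_mul_eval (N := N) p
    (degree_le_natDegree.trans_lt (by exact_mod_cast (by omega : p.natDegree < 2 * N)))
  have hfi : IntervalIntegrable f volume (-1) 1 :=
    ContinuousOn.intervalIntegrable (by rwa [Set.uIcc_of_le (by norm_num)])
  have h1 : |∑ x ∈ glNodes N, glWeight N x * f x - ∑ x ∈ glNodes N, glWeight N x * p.eval x|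
      ≤ 2 * (ε / 5) := by
    rw [← Finset.sum_sub_distrib, ← sum_glWeight (by omega : 0 < N), Finset.sum_mul]
    refine (Finset.abs_sum_le_sum_abs _ _).trans (Finset.sum_le_sum fun x hx => ?_)
    rw [← mul_sub, abs_mul, abs_of_nonneg (glWeight_nonneg hx), abs_sub_comm]
    exact mul_le_mul_of_nonneg_left (hp x (glNodes_subset_Icc hx)).le (glWeight_nonneg hx)
  have h2 : |(∫ x in (-1 : ℝ)..1, p.eval x) - ∫ x in (-1 : ℝ)..1, f x| ≤ 2 * (ε / 5) := by
    rw [← intervalIntegral.integral_sub (intervalIntegrable_eval _ _ _) hfi]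
    have := intervalIntegral.norm_integral_le_of_norm_le_const (a := -1) (b := 1)
      (f := fun x => p.eval x - f x) (C := ε / 5) (fun x hx => by
        rw [Set.uIoc_of_le (by norm_num)] at hx
        exact (hp x ⟨hx.1.le, hx.2⟩).le)
    rw [Real.norm_eq_abs] at this
    refine this.trans (le_of_eq ?_)
    norm_num
    ring
  rw [Real.dist_eq]
  rw [hex] at h1
  calc _ ≤ |∑ x ∈ glNodes N, glWeight N x * f x - ∫ x in (-1 : ℝ)..1, p.eval x| +
        |(∫ x in (-1 : ℝ)..1, p.eval x) - ∫ x in (-1 : ℝ)..1, f x| := abs_sub_le _ _ _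
    _ ≤ 2 * (ε / 5) + 2 * (ε / 5) := add_le_add h1 h2
    _ < ε := by linarith

end GaussLegendre

/-! ### Averages over dilations and their Mellin transforms -/

/-- The average `y ↦ ∫_U w(u) K(φ(u) y) du` of the dilates of `K` with weight `w`. -/
noncomputable def dilationMix (U : Set ℝ) (w φ K : ℝ → ℝ) (y : ℝ) : ℝ := ∫ u in U, w u * K (φ u * y)

section DilationMix

variable {U : Set ℝ} {w φ K : ℝ → ℝ}

lemma integral_norm_cpow_mul_comp_mul_left (f : ℝ → ℂ) (s : ℂ) {a : ℝ} (ha : 0 < a) :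
    ∫ z in Set.Ioi (0 : ℝ), ‖(z : ℂ) ^ (s - 1) * f (a * z)‖ =
      a ^ (-s.re) * ∫ z in Set.Ioi (0 : ℝ), ‖(z : ℂ) ^ (s - 1) * f z‖ := by
  have h := integral_comp_mul_left_Ioi (fun z : ℝ => ‖(z : ℂ) ^ (s - 1) * f z‖) 0 ha
  rw [mul_zero, smul_eq_mul] at h
  have h2 : ∫ z in Set.Ioi (0 : ℝ), ‖((a * z : ℝ) : ℂ) ^ (s - 1) * f (a * z)‖ =
      a ^ (s.re - 1) * ∫ z in Set.Ioi (0 : ℝ), ‖(z : ℂ) ^ (s - 1) * f (a * z)‖ := by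
    rw [← integral_const_mul]
    refine setIntegral_congr_fun measurableSet_Ioi fun z hz => ?_
    have hz : 0 < z := hz
    simp only [norm_mul]
    rw [Complex.norm_cpow_eq_rpow_re_of_pos (by positivity),
      Complex.norm_cpow_eq_rpow_re_of_pos hz, Real.mul_rpow ha.le hz.le]
    simp only [Complex.sub_re, Complex.one_re]
    ring
  rw [h2] at h
  have h3 : a ^ (s.re - 1) * a ^ (-s.re) = a⁻¹ := by
    rw [← Real.rpow_add ha, ← Real.rpow_neg_one]; congr 1; ring
  have h4 : a ^ (s.re - 1) ≠ 0 := (Real.rpow_pos_of_pos ha _).ne'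
  apply mul_left_cancel₀ h4
  rw [h, ← mul_assoc, h3]

/-- The Mellin transform turns an average over dilations into a product (Fubini). -/
lemma hasMellin_dilationMix (hU : MeasurableSet U) (hφ0 : ∀ u ∈ U, 0 < φ u)
    (hw : Measurable w) (hφ : Measurable φ) (hK : Measurable K) {s k : ℂ}
    (hint : IntegrableOn (fun u => (w u : ℂ) * (φ u : ℂ) ^ (-s)) U)
    (hKs : HasMellin (fun y => (K y : ℂ)) s k) :
    HasMellin (fun y => (dilationMix U w φ K y : ℂ)) s
      ((∫ u in U, (w u : ℂ) * (φ u : ℂ) ^ (-s)) * k) := by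
  set F : ℝ × ℝ → ℂ := fun p => (p.1 : ℂ) ^ (s - 1) * ((w p.2 : ℂ) * (K (φ p.2 * p.1) : ℂ))
    with hF
  have hFm : Measurable F := by
    simp only [hF]
    fun_prop
  have hFint : Integrable F ((volume.restrict (Set.Ioi 0)).prod (volume.restrict U)) := by
    rw [integrable_prod_iff' hFm.aestronglyMeasurable]
    constructor
    · refine (ae_restrict_iff' hU).2 (Eventually.of_forall fun u hu => ?_)
      have := ((MellinConvergent.comp_mul_left (hφ0 u hu)).2 hKs.1)
      have h2 := this.const_smul (w u : ℂ)
      simpa only [MellinConvergent, smul_eq_mul] using! h2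
    · have h1 : IntegrableOn (fun u => ‖(w u : ℂ) * (φ u : ℂ) ^ (-s)‖ *
          ∫ z in Set.Ioi (0 : ℝ), ‖(z : ℂ) ^ (s - 1) * (K z : ℂ)‖) U := hint.norm.mul_const _
      refine h1.congr_fun (fun u hu => ?_) hU
      simp only [hF]
      have h2 := integral_norm_cpow_mul_comp_mul_left (fun z => (K z : ℂ)) s (hφ0 u hu)
      calc ‖(w u : ℂ) * (φ u : ℂ) ^ (-s)‖ *
            ∫ z in Set.Ioi (0 : ℝ), ‖(z : ℂ) ^ (s - 1) * (K z : ℂ)‖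
          = ‖(w u : ℂ)‖ * ∫ z in Set.Ioi (0 : ℝ), ‖(z : ℂ) ^ (s - 1) * (K (φ u * z) : ℂ)‖ := by
            rw [h2, norm_mul, Complex.norm_cpow_eq_rpow_re_of_pos (hφ0 u hu), Complex.neg_re]
            ring
        _ = _ := by
            rw [← integral_const_mul]
            congr 1 with z
            rw [← norm_mul]
            congr 1
            ring
  have hL : ∀ z : ℝ, ∫ u in U, F (z, u) =
      (z : ℂ) ^ (s - 1) • (dilationMix U w φ K z : ℂ) := by
    intro z
    simp only [hF, dilationMix]
    rw [integral_const_mul, smul_eq_mul, ← integral_complex_ofReal]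
    push_cast
    rfl
  constructor
  · have := hFint.integral_prod_left
    simp only [hL] at this
    exact this
  · have hsw := integral_integral_swap (f := fun z u => F (z, u)) hFint
    simp only [hL] at hsw
    rw [mellin, hsw, ← integral_mul_const]
    refine setIntegral_congr_fun hU fun u hu => ?_
    have h3 := mellin_comp_mul_left (fun y => (K y : ℂ)) s (hφ0 u hu)
    rw [hKs.2, mellin] at h3
    simp only [smul_eq_mul] at h3
    simp only [hF]
    rw [mul_assoc, ← h3, ← integral_const_mul]
    congr 1 with z
    ring

lemma measurable_dilationMix (hw : Measurable w) (hφ : Measurable φ) (hK : Measurable K) :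
    Measurable (dilationMix U w φ K) := by
  have h : Measurable (Function.uncurry fun y u => w u * K (φ u * y)) := by
    unfold Function.uncurry
    fun_prop
  exact (h.stronglyMeasurable.integral_prod_right (ν := volume.restrict U)).measurable

variable {C c : ℝ}

lemma norm_mul_comp_le (hφ0 : ∀ u ∈ U, 0 < φ u) (hC : ∀ y > 0, |K y| ≤ C * y ^ (-c))
    {u y : ℝ} (hu : u ∈ U) (hy : 0 < y) :
    ‖w u * K (φ u * y)‖ ≤ C * y ^ (-c) * ‖w u * φ u ^ (-c)‖ := by
  have h1 := hC (φ u * y) (mul_pos (hφ0 u hu) hy)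
  rw [Real.mul_rpow (hφ0 u hu).le hy.le] at h1
  rw [norm_mul, norm_mul, Real.norm_eq_abs (K _),
    Real.norm_of_nonneg (Real.rpow_nonneg (hφ0 u hu).le _)]
  calc ‖w u‖ * |K (φ u * y)| ≤ ‖w u‖ * (C * (φ u ^ (-c) * y ^ (-c))) := by gcongr
    _ = _ := by ring

lemma integrableOn_dilationMix (hU : MeasurableSet U) (hφ0 : ∀ u ∈ U, 0 < φ u)
    (hw : Measurable w) (hφ : Measurable φ) (hK : Measurable K)
    (hC : ∀ y > 0, |K y| ≤ C * y ^ (-c))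
    (hint : IntegrableOn (fun u => w u * φ u ^ (-c)) U) {y : ℝ} (hy : 0 < y) :
    IntegrableOn (fun u => w u * K (φ u * y)) U := by
  refine (hint.norm.const_mul (C * y ^ (-c))).mono' (by fun_prop) ?_
  exact (ae_restrict_iff' hU).2 (Eventually.of_forall fun u hu => norm_mul_comp_le hφ0 hC hu hy)

lemma abs_dilationMix_le (hU : MeasurableSet U) (hφ0 : ∀ u ∈ U, 0 < φ u)
    (hC : ∀ y > 0, |K y| ≤ C * y ^ (-c))
    (hint : IntegrableOn (fun u => w u * φ u ^ (-c)) U) {y : ℝ} (hy : 0 < y) :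
    |dilationMix U w φ K y| ≤ (C * ∫ u in U, ‖w u * φ u ^ (-c)‖) * y ^ (-c) := by
  have := norm_integral_le_of_norm_le (hint.norm.const_mul (C * y ^ (-c)))
    ((ae_restrict_iff' hU).2 (Eventually.of_forall fun u hu =>
      norm_mul_comp_le (w := w) hφ0 hC hu hy))
  rw [integral_const_mul] at this
  calc _ ≤ _ := this
    _ = _ := by ring

lemma continuousOn_dilationMix (hU : MeasurableSet U) (hφ0 : ∀ u ∈ U, 0 < φ u)
    (hw : Measurable w) (hφ : Measurable φ) (hK : Measurable K)
    (hKc : ContinuousOn K (Set.Ioi 0)) (hc : 0 ≤ c) (hC0 : 0 ≤ C)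
    (hC : ∀ y > 0, |K y| ≤ C * y ^ (-c))
    (hint : IntegrableOn (fun u => w u * φ u ^ (-c)) U) :
    ContinuousOn (dilationMix U w φ K) (Set.Ioi 0) := by
  intro y₀ hy₀
  have hy₀ : 0 < y₀ := hy₀
  refine ContinuousAt.continuousWithinAt ?_
  refine continuousAt_of_dominated (bound := fun u => C * (y₀ / 2) ^ (-c) * ‖w u * φ u ^ (-c)‖)
    ?_ ?_ (hint.norm.const_mul _) ?_
  · exact Eventually.of_forall fun y => by fun_prop
  · filter_upwards [lt_mem_nhds (half_lt_self hy₀)] with y hy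
    refine (ae_restrict_iff' hU).2 (Eventually.of_forall fun u hu => ?_)
    refine (norm_mul_comp_le hφ0 hC hu ((half_pos hy₀).trans hy)).trans ?_
    have : y ^ (-c) ≤ (y₀ / 2) ^ (-c) :=
      Real.rpow_le_rpow_of_nonpos (half_pos hy₀) hy.le (by linarith)
    gcongr
  · refine (ae_restrict_iff' hU).2 (Eventually.of_forall fun u hu => ?_)
    have h1 : ContinuousAt K (φ u * y₀) :=
      hKc.continuousAt (Ioi_mem_nhds (mul_pos (hφ0 u hu) hy₀))
    have h2 : ContinuousAt (fun y => K (φ u * y)) y₀ :=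
      ContinuousAt.comp (f := fun y => φ u * y) h1 (by fun_prop)
    exact continuousAt_const.mul h2

end DilationMix

/-! ### Three elementary Mellin transforms -/

lemma integrableOn_cpow_Ioo {p : ℂ} (hp : 0 < p.re) :
    IntegrableOn (fun u : ℝ => (u : ℂ) ^ (p - 1)) (Set.Ioo 0 1) ∧
      ∫ u in Set.Ioo (0 : ℝ) 1, (u : ℂ) ^ (p - 1) = 1 / p := by
  have h1 : -1 < (p - 1).re := by simp [hp]
  have h0 : p ≠ 0 := by rintro rfl; simp at hp
  constructor
  · have := intervalIntegral.intervalIntegrable_cpow' (a := 0) (b := 1) h1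
    rw [intervalIntegrable_iff_integrableOn_Ioo_of_le zero_le_one] at this
    exact this
  · rw [← integral_Ioc_eq_integral_Ioo, ← intervalIntegral.integral_of_le zero_le_one,
      integral_cpow (Or.inl h1)]
    simp [Complex.zero_cpow h0]

/-- Differentiate `∫₀¹ u ^ (p - 1) du = 1 / p` in `p`. -/
lemma integrableOn_log_mul_cpow_Ioo {p : ℂ} (hp : 0 < p.re) :
    IntegrableOn (fun u : ℝ => ((-Real.log u : ℝ) : ℂ) * (u : ℂ) ^ (p - 1)) (Set.Ioo 0 1) ∧
      ∫ u in Set.Ioo (0 : ℝ) 1, ((-Real.log u : ℝ) : ℂ) * (u : ℂ) ^ (p - 1) = 1 / p ^ 2 := by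
  have h0 : p ≠ 0 := by rintro rfl; simp at hp
  set f : ℝ → ℂ := Set.indicator (Set.Ioc 0 1) (fun _ => (1 : ℂ)) with hf
  have hloc : LocallyIntegrableOn f (Set.Ioi 0) :=
    ((integrable_indicator_iff measurableSet_Ioc).2
      (by simp)).locallyIntegrable.locallyIntegrableOn _
  have htop : f =O[atTop] (fun x : ℝ => x ^ (-(p.re + 1))) := by
    refine Asymptotics.IsBigO.of_bound 0 ?_
    filter_upwards [eventually_gt_atTop 1] with x hx
    simp [hf, not_le.2 hx]
  have hbot : f =O[𝓝[>] 0] (fun x : ℝ => x ^ (-(0 : ℝ))) := by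
    refine Asymptotics.IsBigO.of_bound 1 (Eventually.of_forall fun x => ?_)
    simp only [neg_zero, Real.rpow_zero, norm_one, mul_one, hf, Set.indicator]
    split_ifs <;> simp
  obtain ⟨hc, hd⟩ := mellin_hasDerivAt_of_isBigO_rpow hloc htop (by linarith) hbot hp
  have heq : ∀ u : ℝ, (u : ℂ) ^ (p - 1) • (fun t => Real.log t • f t) u =
      Set.indicator (Set.Ioc 0 1) (fun u : ℝ => -(((-Real.log u : ℝ) : ℂ) * (u : ℂ) ^ (p - 1))) u := by
    intro u
    simp only [hf, Set.indicator]
    split_ifs <;> simp [mul_comm]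
  have hsub : Set.Ioi (0 : ℝ) ∩ Set.Ioc 0 1 = Set.Ioc 0 1 :=
    Set.inter_eq_right.2 fun x hx => hx.1
  have hc' : IntegrableOn (fun u : ℝ => -(((-Real.log u : ℝ) : ℂ) * (u : ℂ) ^ (p - 1)))
      (Set.Ioc 0 1) := by
    rw [MellinConvergent] at hc
    simp only [heq] at hc
    rw [integrableOn_indicator_iff measurableSet_Ioc, Set.inter_comm, hsub] at hc
    exact hc
  refine ⟨?_, ?_⟩
  · have := hc'.neg.mono_set Set.Ioo_subset_Ioc_self
    simpa using! this
  · have hev : mellin f =ᶠ[𝓝 p] fun s => s⁻¹ := by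
      filter_upwards [(isOpen_lt continuous_const Complex.continuous_re).mem_nhds hp] with s hs
      rw [(hasMellin_one_Ioc hs).2, one_div]
    have hval := hd.unique ((hasDerivAt_inv h0).congr_of_eventuallyEq hev)
    rw [mellin] at hval
    simp only [heq] at hval
    rw [setIntegral_indicator measurableSet_Ioc, hsub, integral_neg,
      integral_Ioc_eq_integral_Ioo] at hval
    rw [← neg_inj, hval, one_div]

/-- The Mellin transform of `(1 + y)^{-M}`, by averaging the dilates of `exp (-y)` against
the weight `u^{M-1} exp (-u)`. -/
lemma hasMellin_one_add_rpow {M : ℝ} {s : ℂ} (hs : 0 < s.re) (hsM : s.re < M) :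
    HasMellin (fun y : ℝ => ((Real.Gamma M * (1 + y) ^ (-M) : ℝ) : ℂ)) s
      (Complex.Gamma s * Complex.Gamma (M - s)) := by
  have hM : 0 < M := hs.trans hsM
  have hexp : ∀ {q : ℂ}, 0 < q.re → HasMellin (fun y : ℝ => ((Real.exp (-y) : ℝ) : ℂ)) q
      (Complex.Gamma q) := by
    intro q hq
    refine ⟨?_, ?_⟩
    · have := Complex.GammaIntegral_convergent hq
      refine this.congr_fun (fun x _ => ?_) measurableSet_Ioi
      simp [mul_comm]
    · rw [Complex.Gamma_eq_integral hq, Complex.GammaIntegral_eq_mellin]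
  have hMs : 0 < ((M : ℂ) - s).re := by simpa using hsM
  have hweight : ∀ u ∈ Set.Ioi (0 : ℝ),
      (u : ℂ) ^ ((M : ℂ) - s - 1) • ((Real.exp (-u) : ℝ) : ℂ) =
        ((u ^ (M - 1) * Real.exp (-u) : ℝ) : ℂ) * (u : ℂ) ^ (-s) := by
    intro u hu
    have hu : 0 < u := hu
    rw [sub_right_comm, sub_eq_add_neg _ s,
      Complex.cpow_add _ _ (by exact_mod_cast hu.ne'), Complex.ofReal_mul,
      Complex.ofReal_cpow hu.le, smul_eq_mul]
    push_cast
    ring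
  have hint := (hexp hMs).1.congr_fun hweight measurableSet_Ioi
  have hval := (hexp hMs).2
  rw [mellin, setIntegral_congr_fun measurableSet_Ioi hweight] at hval
  have := hasMellin_dilationMix (U := Set.Ioi 0) (w := fun u => u ^ (M - 1) * Real.exp (-u))
    (φ := fun u => u) (K := fun y => Real.exp (-y)) measurableSet_Ioi (fun u hu => hu)
    (by fun_prop) measurable_id (by fun_prop) hint (hexp hs)
  rw [hval] at this
  have hmix : ∀ y ∈ Set.Ioi (0 : ℝ), (dilationMix (Set.Ioi 0)
      (fun u => u ^ (M - 1) * Real.exp (-u)) (fun u => u) (fun y => Real.exp (-y)) y) =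
        Real.Gamma M * (1 + y) ^ (-M) := by
    intro y hy
    have hy : 0 < y := hy
    have h := Real.integral_rpow_mul_exp_neg_mul_Ioi hM (by linarith : 0 < 1 + y)
    rw [one_div, Real.inv_rpow (by linarith), ← Real.rpow_neg (by linarith)] at h
    rw [mul_comm, ← h, dilationMix]
    congr 1 with u
    rw [mul_assoc, ← Real.exp_add]
    ring_nf
  refine ⟨this.1.congr_fun (fun y hy => by simp only [hmix y hy]) measurableSet_Ioi, ?_⟩
  rw [mul_comm (Complex.Gamma s), ← this.2]
  exact setIntegral_congr_fun measurableSet_Ioi fun y hy => by simp only [hmix y hy]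

/-! ### Real integral representations of the two Fox functions -/

/-- The function on `(0, ∞)` whose Mellin transform is `Γ(s) Γ(M - s) / (ν + α s)²`: the average
of `Γ(M) (1 + y)^{-M}` over dilations by a power of the misalignment gain. -/
noncomputable def fadingMix (M ν α : ℝ) : ℝ → ℝ :=
  dilationMix (Set.Ioo 0 1) (fun z => -Real.log z * z ^ (ν / 2 - 1) / 4) (fun z => z ^ (-(α / 2)))
    (fun y => Real.Gamma M * (1 + y) ^ (-M))

/-- The function on `(0, ∞)` whose Mellin transform is `Γ(s) Γ(M - s) / ((ν + α s)² (μ - s))`. -/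
noncomputable def fadingMixCDF (M ν α μ : ℝ) : ℝ → ℝ :=
  dilationMix (Set.Ioo 0 1) (fun v => α / 2 * v ^ (α * μ / 2 - 1)) (fun v => v ^ (α / 2))
    (fadingMix M ν α)

lemma integrableOn_mul_rpow_of_cpow {U : Set ℝ} (hU : MeasurableSet U) {w φ : ℝ → ℝ}
    (hφ : ∀ u ∈ U, 0 < φ u) {c : ℝ}
    (h : IntegrableOn (fun u => (w u : ℂ) * (φ u : ℂ) ^ (-(c : ℂ))) U) :
    IntegrableOn (fun u => w u * φ u ^ (-c)) U := by
  have h1 : IntegrableOn (fun u => ((w u * φ u ^ (-c) : ℝ) : ℂ)) U := by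
    refine h.congr_fun (fun u hu => ?_) hU
    rw [Complex.ofReal_mul, Complex.ofReal_cpow (hφ u hu).le, Complex.ofReal_neg]
  exact h1.re

section Weights

variable {M ν α μ : ℝ}

lemma rpow_pos_Ioo (a : ℝ) : ∀ z ∈ Set.Ioo (0 : ℝ) 1, 0 < z ^ a :=
  fun _ hz => Real.rpow_pos_of_pos hz.1 _

lemma fadingWeight_integral {s : ℂ} (hs : 0 < ν + α * s.re) :
    IntegrableOn (fun z : ℝ => ((-Real.log z * z ^ (ν / 2 - 1) / 4 : ℝ) : ℂ) *
        ((z ^ (-(α / 2)) : ℝ) : ℂ) ^ (-s)) (Set.Ioo 0 1) ∧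
      ∫ z in Set.Ioo (0 : ℝ) 1, ((-Real.log z * z ^ (ν / 2 - 1) / 4 : ℝ) : ℂ) *
        ((z ^ (-(α / 2)) : ℝ) : ℂ) ^ (-s) = 1 / (ν + α * s) ^ 2 := by
  have hp : 0 < ((ν + α * s) / 2 : ℂ).re := by
    simpa using hs
  have heq : ∀ z ∈ Set.Ioo (0 : ℝ) 1,
      (1 / 4 : ℂ) * (((-Real.log z : ℝ) : ℂ) * (z : ℂ) ^ ((ν + α * s) / 2 - 1)) =
        ((-Real.log z * z ^ (ν / 2 - 1) / 4 : ℝ) : ℂ) * ((z ^ (-(α / 2)) : ℝ) : ℂ) ^ (-s) := by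
    intro z hz
    have h1 : ((z ^ (-(α / 2)) : ℝ) : ℂ) ^ (-s) = (z : ℂ) ^ (α / 2 * s : ℂ) := by
      rw [Complex.cpow_def_of_ne_zero (by exact_mod_cast (rpow_pos_Ioo _ z hz).ne'),
        Complex.cpow_def_of_ne_zero (by exact_mod_cast hz.1.ne'), ← Complex.ofReal_log
        (rpow_pos_Ioo _ z hz).le, Real.log_rpow hz.1, ← Complex.ofReal_log hz.1.le]
      push_cast
      ring_nf
    have h2 : (ν + α * s) / 2 - 1 = ((ν / 2 - 1 : ℝ) : ℂ) + α / 2 * s := by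
      push_cast; ring
    rw [h1, h2, Complex.cpow_add _ _ (by exact_mod_cast hz.1.ne'), Complex.ofReal_div,
      Complex.ofReal_mul, Complex.ofReal_cpow hz.1.le]
    push_cast
    ring
  obtain ⟨hi, hv⟩ := integrableOn_log_mul_cpow_Ioo hp
  refine ⟨IntegrableOn.congr_fun (hi.const_mul (1 / 4 : ℂ)) heq measurableSet_Ioo, ?_⟩
  rw [← setIntegral_congr_fun measurableSet_Ioo heq, integral_const_mul, hv]
  have h0 : (ν + α * s : ℂ) ≠ 0 := by
    intro h
    rw [h] at hp
    simp at hp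
  field_simp
  norm_num

lemma cdfWeight_integral (hα : 0 < α) {s : ℂ} (hs : s.re < μ) :
    IntegrableOn (fun v : ℝ => ((α / 2 * v ^ (α * μ / 2 - 1) : ℝ) : ℂ) *
        ((v ^ (α / 2) : ℝ) : ℂ) ^ (-s)) (Set.Ioo 0 1) ∧
      ∫ v in Set.Ioo (0 : ℝ) 1, ((α / 2 * v ^ (α * μ / 2 - 1) : ℝ) : ℂ) *
        ((v ^ (α / 2) : ℝ) : ℂ) ^ (-s) = 1 / (μ - s) := by
  have hp : 0 < (α * (μ - s) / 2 : ℂ).re := by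
    have : 0 < α * (μ - s.re) := mul_pos hα (by linarith)
    simpa using this
  have heq : ∀ z ∈ Set.Ioo (0 : ℝ) 1,
      (α / 2 : ℂ) * (z : ℂ) ^ (α * (μ - s) / 2 - 1) =
        ((α / 2 * z ^ (α * μ / 2 - 1) : ℝ) : ℂ) * ((z ^ (α / 2) : ℝ) : ℂ) ^ (-s) := by
    intro z hz
    have h1 : ((z ^ (α / 2) : ℝ) : ℂ) ^ (-s) = (z : ℂ) ^ (-(α / 2 * s) : ℂ) := by
      rw [Complex.cpow_def_of_ne_zero (by exact_mod_cast (rpow_pos_Ioo _ z hz).ne'),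
        Complex.cpow_def_of_ne_zero (by exact_mod_cast hz.1.ne'), ← Complex.ofReal_log
        (rpow_pos_Ioo _ z hz).le, Real.log_rpow hz.1, ← Complex.ofReal_log hz.1.le]
      push_cast
      ring_nf
    have h2 : α * (μ - s) / 2 - 1 = ((α * μ / 2 - 1 : ℝ) : ℂ) + -(α / 2 * s) := by
      push_cast; ring
    rw [h1, h2, Complex.cpow_add _ _ (by exact_mod_cast hz.1.ne'),
      Complex.ofReal_mul, Complex.ofReal_cpow hz.1.le]
    push_cast
    ring
  obtain ⟨hi, hv⟩ := integrableOn_cpow_Ioo hp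
  refine ⟨IntegrableOn.congr_fun (hi.const_mul (α / 2 : ℂ)) heq measurableSet_Ioo, ?_⟩
  rw [← setIntegral_congr_fun measurableSet_Ioo heq, integral_const_mul, hv]
  have h0 : (μ - s : ℂ) ≠ 0 := by
    intro h
    rw [mul_div_assoc, h] at hp
    simp at hp
  have hα' : (α : ℂ) ≠ 0 := by exact_mod_cast hα.ne'
  field_simp

lemma hasMellin_fadingMix {s : ℂ} (hs : 0 < s.re) (hsM : s.re < M) (hν : 0 < ν + α * s.re) :
    HasMellin (fun y => (fadingMix M ν α y : ℂ)) s
      (1 / (ν + α * s) ^ 2 * (Complex.Gamma s * Complex.Gamma (M - s))) := by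
  have := hasMellin_dilationMix measurableSet_Ioo (rpow_pos_Ioo (-(α / 2))) (by fun_prop)
    (by fun_prop) (by fun_prop) (fadingWeight_integral hν).1 (hasMellin_one_add_rpow hs hsM)
  rwa [(fadingWeight_integral hν).2] at this

lemma measurable_fadingMix : Measurable (fadingMix M ν α) :=
  measurable_dilationMix (by fun_prop) (by fun_prop) (by fun_prop)

lemma measurable_fadingMixCDF : Measurable (fadingMixCDF M ν α μ) :=
  measurable_dilationMix (by fun_prop) (by fun_prop) measurable_fadingMix

lemma hasMellin_fadingMixCDF (hα : 0 < α) {s : ℂ} (hs : 0 < s.re) (hsM : s.re < M)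
    (hν : 0 < ν + α * s.re) (hsμ : s.re < μ) :
    HasMellin (fun y => (fadingMixCDF M ν α μ y : ℂ)) s
      (1 / (μ - s) * (1 / (ν + α * s) ^ 2 * (Complex.Gamma s * Complex.Gamma (M - s)))) := by
  have := hasMellin_dilationMix measurableSet_Ioo (rpow_pos_Ioo (α / 2)) (by fun_prop)
    (by fun_prop) measurable_fadingMix (cdfWeight_integral hα hsμ).1
    (hasMellin_fadingMix hs hsM hν)
  rwa [(cdfWeight_integral hα hsμ).2] at this

variable {c : ℝ}

lemma abs_Gamma_mul_one_add_rpow_le (hc : 0 ≤ c) (hcM : c < M) :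
    ∀ y > 0, |Real.Gamma M * (1 + y) ^ (-M)| ≤ Real.Gamma M * y ^ (-c) := by
  intro y hy
  have hG := Real.Gamma_pos_of_pos (hc.trans_lt hcM)
  rw [abs_of_pos (mul_pos hG (Real.rpow_pos_of_pos (by linarith) _))]
  refine mul_le_mul_of_nonneg_left ?_ hG.le
  calc (1 + y) ^ (-M) ≤ (1 + y) ^ (-c) :=
        Real.rpow_le_rpow_of_exponent_le (by linarith) (by linarith)
    _ ≤ y ^ (-c) := Real.rpow_le_rpow_of_nonpos hy (by linarith) (by linarith)

lemma continuousOn_Gamma_mul_one_add_rpow :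
    ContinuousOn (fun y => Real.Gamma M * (1 + y) ^ (-M)) (Set.Ioi 0) := by
  refine continuousOn_const.mul (ContinuousOn.rpow_const (by fun_prop) fun y hy => Or.inl ?_)
  have : 0 < y := hy
  positivity

lemma fadingWeight_integrableOn (hν : 0 < ν + α * c) :
    IntegrableOn (fun z : ℝ => (-Real.log z * z ^ (ν / 2 - 1) / 4) * (z ^ (-(α / 2))) ^ (-c))
      (Set.Ioo 0 1) :=
  integrableOn_mul_rpow_of_cpow measurableSet_Ioo (rpow_pos_Ioo _)
    (fadingWeight_integral (s := c) (by simpa using hν)).1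

lemma cdfWeight_integrableOn (hα : 0 < α) (hcμ : c < μ) :
    IntegrableOn (fun v : ℝ => (α / 2 * v ^ (α * μ / 2 - 1)) * (v ^ (α / 2)) ^ (-c))
      (Set.Ioo 0 1) :=
  integrableOn_mul_rpow_of_cpow measurableSet_Ioo (rpow_pos_Ioo _)
    (cdfWeight_integral hα (s := c) (by simpa using hcμ)).1

lemma exists_abs_fadingMix_le (hc : 0 ≤ c) (hcM : c < M) (hν : 0 < ν + α * c) :
    ∃ C, 0 ≤ C ∧ ∀ y > 0, |fadingMix M ν α y| ≤ C * y ^ (-c) :=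
  ⟨_, mul_nonneg (Real.Gamma_pos_of_pos (hc.trans_lt hcM)).le
      (integral_nonneg fun _ => norm_nonneg _), fun _ hy =>
    abs_dilationMix_le measurableSet_Ioo (rpow_pos_Ioo _) (abs_Gamma_mul_one_add_rpow_le hc hcM)
      (fadingWeight_integrableOn hν) hy⟩

lemma integrableOn_fadingMix (hc : 0 ≤ c) (hcM : c < M) (hν : 0 < ν + α * c) {y : ℝ}
    (hy : 0 < y) :
    IntegrableOn (fun z : ℝ => (-Real.log z * z ^ (ν / 2 - 1) / 4) *
      (Real.Gamma M * (1 + z ^ (-(α / 2)) * y) ^ (-M))) (Set.Ioo 0 1) :=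
  integrableOn_dilationMix (K := fun y => Real.Gamma M * (1 + y) ^ (-M)) measurableSet_Ioo
    (rpow_pos_Ioo (-(α / 2))) (by fun_prop) (by fun_prop)
    (by fun_prop) (abs_Gamma_mul_one_add_rpow_le hc hcM) (fadingWeight_integrableOn hν) hy

lemma continuousOn_fadingMix (hc : 0 ≤ c) (hcM : c < M) (hν : 0 < ν + α * c) :
    ContinuousOn (fadingMix M ν α) (Set.Ioi 0) :=
  continuousOn_dilationMix measurableSet_Ioo (rpow_pos_Ioo _) (by fun_prop) (by fun_prop)
    (by fun_prop) continuousOn_Gamma_mul_one_add_rpow hc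
    (Real.Gamma_pos_of_pos (hc.trans_lt hcM)).le
    (abs_Gamma_mul_one_add_rpow_le hc hcM) (fadingWeight_integrableOn hν)

lemma exists_abs_fadingMixCDF_le (hα : 0 < α) (hc : 0 ≤ c) (hcM : c < M) (hν : 0 < ν + α * c)
    (hcμ : c < μ) : ∃ C, 0 ≤ C ∧ ∀ y > 0, |fadingMixCDF M ν α μ y| ≤ C * y ^ (-c) := by
  obtain ⟨C, hC0, hC⟩ := exists_abs_fadingMix_le hc hcM hν
  exact ⟨_, mul_nonneg hC0 (integral_nonneg fun _ => norm_nonneg _), fun _ hy =>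
    abs_dilationMix_le measurableSet_Ioo (rpow_pos_Ioo _) hC
      (cdfWeight_integrableOn hα hcμ) hy⟩

lemma integrableOn_fadingMixCDF (hα : 0 < α) (hc : 0 ≤ c) (hcM : c < M) (hν : 0 < ν + α * c)
    (hcμ : c < μ) {y : ℝ} (hy : 0 < y) :
    IntegrableOn (fun v : ℝ => (α / 2 * v ^ (α * μ / 2 - 1)) *
      fadingMix M ν α (v ^ (α / 2) * y)) (Set.Ioo 0 1) := by
  obtain ⟨C, hC0, hC⟩ := exists_abs_fadingMix_le hc hcM hν
  exact integrableOn_dilationMix measurableSet_Ioo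
    (rpow_pos_Ioo _) (by fun_prop) (by fun_prop) measurable_fadingMix hC
      (cdfWeight_integrableOn hα hcμ) hy

lemma continuousOn_fadingMixCDF (hα : 0 < α) (hc : 0 ≤ c) (hcM : c < M) (hν : 0 < ν + α * c)
    (hcμ : c < μ) : ContinuousOn (fadingMixCDF M ν α μ) (Set.Ioi 0) := by
  obtain ⟨C, hC0, hC⟩ := exists_abs_fadingMix_le hc hcM hν
  exact continuousOn_dilationMix measurableSet_Ioo (rpow_pos_Ioo _) (by fun_prop) (by fun_prop)
    measurable_fadingMix (continuousOn_fadingMix hc hcM hν) hc hC0 hC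
    (cdfWeight_integrableOn hα hcμ)

lemma fadingMix_nonneg (hM : 0 < M) {y : ℝ} (hy : 0 < y) : 0 ≤ fadingMix M ν α y := by
  refine setIntegral_nonneg measurableSet_Ioo fun z hz => ?_
  have h1 := Real.log_neg hz.1 hz.2
  have h2 := Real.Gamma_pos_of_pos hM
  have h3 := rpow_pos_Ioo (ν / 2 - 1) z hz
  have h4 := rpow_pos_Ioo (-(α / 2)) z hz
  have h5 : 0 ≤ -Real.log z := by linarith
  positivity

lemma fadingMixCDF_nonneg (hα : 0 < α) (hM : 0 < M) {y : ℝ} (hy : 0 < y) :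
    0 ≤ fadingMixCDF M ν α μ y := by
  refine setIntegral_nonneg measurableSet_Ioo fun z hz => ?_
  have h3 := rpow_pos_Ioo (α * μ / 2 - 1) z hz
  have h4 := fadingMix_nonneg (ν := ν) (α := α) hM (mul_pos (rpow_pos_Ioo (α / 2) z hz) hy)
  positivity

end Weights

/-! ### Mellin–Barnes integrals by Mellin inversion -/

/-- If the kernel is, on all separating lines, the Mellin transform of one continuous function, then
Mellin inversion on each line gives the value of this function. -/
lemma hasFoxH_of_hasMellin {m n p q : ℕ} {a : Fin p → ℝ × ℝ} {b : Fin q → ℝ × ℝ} {h : ℝ → ℝ}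
    (hex : ∃ c, FoxSeparates m n a b c)
    (hmel : ∀ c, FoxSeparates m n a b c → ∀ t : ℝ,
      HasMellin (fun y => (h y : ℂ)) (c + t * Complex.I)
        (foxKernel m n a b (c + t * Complex.I)))
    (hint : ∀ c, FoxSeparates m n a b c →
      Integrable fun t : ℝ => foxKernel m n a b (c + t * Complex.I))
    (hcont : ContinuousOn h (Set.Ioi 0)) {z : ℝ} (hz : 0 < z) :
    HasFoxH m n a b z (h z) := by
  refine ⟨hex, fun c hc => ⟨?_, ?_⟩⟩
  · have hzc : (z : ℂ) ≠ 0 := by exact_mod_cast hz.ne'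
    refine (hint c hc).mul_bdd (c := z ^ (-c)) ?_ (Eventually.of_forall fun t => ?_)
    · refine Continuous.aestronglyMeasurable ?_
      exact Continuous.const_cpow (by fun_prop) (Or.inl hzc)
    · rw [Complex.norm_cpow_eq_rpow_re_of_pos hz]
      simp
  · have hline : ∀ t : ℝ, mellin (fun y => (h y : ℂ)) (c + t * Complex.I) =
        foxKernel m n a b (c + t * Complex.I) := fun t => (hmel c hc t).2
    have hconv : MellinConvergent (fun y => (h y : ℂ)) (c : ℂ) := by
      simpa using (hmel c hc 0).1
    have hvert : Complex.VerticalIntegrable (mellin fun y => (h y : ℂ)) c := by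
      simpa only [Complex.VerticalIntegrable, hline] using hint c hc
    have hca : ContinuousAt (fun y => (h y : ℂ)) z :=
      Complex.continuous_ofReal.continuousAt.comp (hcont.continuousAt (Ioi_mem_nhds hz))
    have hinv := mellinInv_mellin_eq c (fun y => (h y : ℂ)) hz hconv hvert hca
    rw [← hinv, mellinInv]
    simp only [hline, foxIntegrand, smul_eq_mul, Complex.real_smul]
    push_cast
    simp only [mul_comm]

lemma foxH_eq_of_hasFoxH {m n p q : ℕ} {a : Fin p → ℝ × ℝ} {b : Fin q → ℝ × ℝ} {z : ℝ} {v : ℂ}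
    (h : HasFoxH m n a b z v) : foxH m n a b z = v := by
  have hex : ∃ v, HasFoxH m n a b z v := ⟨v, h⟩
  rw [foxH, dif_pos hex]
  obtain ⟨c, hc⟩ := h.1
  rw [← (hex.choose_spec.2 c hc).2, (h.2 c hc).2]

lemma norm_Gamma_le {s : ℂ} (hs : 0 < s.re) : ‖Complex.Gamma s‖ ≤ Real.Gamma s.re := by
  rw [Complex.Gamma_eq_integral hs, Real.Gamma_eq_integral hs]
  refine (norm_integral_le_integral_norm _).trans (le_of_eq ?_)
  refine setIntegral_congr_fun measurableSet_Ioi fun x hx => ?_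
  have hx : 0 < x := hx
  simp only [norm_mul, Complex.norm_real, Real.norm_eq_abs, Real.abs_exp]
  rw [Complex.norm_cpow_eq_rpow_re_of_pos hx]
  simp

lemma continuous_Gamma_comp {f : ℝ → ℂ} (hf : Continuous f) (hpos : ∀ t, 0 < (f t).re) :
    Continuous fun t => Complex.Gamma (f t) := by
  refine continuous_iff_continuousAt.2 fun t => ?_
  refine ContinuousAt.comp (f := f) (Complex.differentiableAt_Gamma _ fun k hk => ?_).continuousAt
    hf.continuousAt
  have := hpos t
  rw [hk] at this
  simp at this
  linarith [Nat.cast_nonneg (α := ℝ) k]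

/-- The factor `(ν + α s)⁻²` alone makes the Mellin–Barnes integral converge absolutely, the Gamma
functions being bounded on vertical lines in the right half-plane. -/
lemma integrable_kernel_vertical {M ν α c : ℝ} (hα : 0 < α) (hc : 0 < c) (hcM : c < M)
    (hν : 0 < ν + α * c) :
    Integrable fun t : ℝ => 1 / ((ν : ℂ) + α * (c + t * Complex.I)) ^ 2 *
      (Complex.Gamma (c + t * Complex.I) * Complex.Gamma (M - (c + t * Complex.I))) := by
  set A := Real.Gamma c * Real.Gamma (M - c) with hA
  set k := min ((ν + α * c) ^ 2) (α ^ 2) with hk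
  have hk0 : 0 < k := lt_min (by positivity) (by positivity)
  have hG0 : 0 ≤ A := mul_nonneg (Real.Gamma_pos_of_pos hc).le
    (Real.Gamma_pos_of_pos (by linarith)).le
  have hne : ∀ t : ℝ, (ν : ℂ) + α * (c + t * Complex.I) ≠ 0 := by
    intro t h
    have := congrArg Complex.re h
    simp at this
    linarith
  refine (integrable_inv_one_add_sq.const_mul (A / k)).mono' ?_ (Eventually.of_forall fun t => ?_)
  · refine Continuous.aestronglyMeasurable ?_
    refine Continuous.mul ?_ (Continuous.mul ?_ ?_)
    · exact continuous_const.div (by fun_prop) fun t => pow_ne_zero 2 (hne t)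
    · exact continuous_Gamma_comp (by fun_prop) fun t => by simpa using hc
    · exact continuous_Gamma_comp (by fun_prop) fun t => by simpa using hcM
  · have h1 : ‖Complex.Gamma (c + t * Complex.I)‖ ≤ Real.Gamma c := by
      simpa using norm_Gamma_le (s := c + t * Complex.I) (by simpa using hc)
    have h2 : ‖Complex.Gamma (M - (c + t * Complex.I))‖ ≤ Real.Gamma (M - c) := by
      simpa using norm_Gamma_le (s := M - (c + t * Complex.I)) (by simpa using hcM)
    have h12 := mul_le_mul h1 h2 (norm_nonneg _) (Real.Gamma_pos_of_pos hc).le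
    have h3 : k * (1 + t ^ 2) ≤ ‖((ν : ℂ) + α * (c + t * Complex.I)) ^ 2‖ := by
      rw [norm_pow, ← Complex.normSq_eq_norm_sq, Complex.normSq_apply]
      simp only [Complex.add_re, Complex.ofReal_re, Complex.mul_re, Complex.I_re, mul_zero,
        Complex.ofReal_im, Complex.I_im, mul_one, sub_self, add_zero, Complex.add_im,
        Complex.mul_im, zero_mul, sub_zero, zero_add]
      have := min_le_left ((ν + α * c) ^ 2) (α ^ 2)
      have h5 := mul_le_mul_of_nonneg_right (min_le_right ((ν + α * c) ^ 2) (α ^ 2)) (sq_nonneg t)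
      rw [← hk] at this h5
      nlinarith
    rw [norm_mul, norm_mul, norm_div, norm_one]
    calc 1 / ‖((ν : ℂ) + α * (c + t * Complex.I)) ^ 2‖ *
          (‖Complex.Gamma (c + t * Complex.I)‖ * ‖Complex.Gamma (M - (c + t * Complex.I))‖)
        ≤ 1 / (k * (1 + t ^ 2)) * A := by gcongr
      _ = A / k * (1 + t ^ 2)⁻¹ := by field_simp

lemma integrable_kernel_vertical_div {M ν α μ c : ℝ} (hα : 0 < α) (hc : 0 < c) (hcM : c < M)
    (hν : 0 < ν + α * c) (hcμ : c < μ) :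
    Integrable fun t : ℝ => 1 / ((μ : ℂ) - (c + t * Complex.I)) *
      (1 / ((ν : ℂ) + α * (c + t * Complex.I)) ^ 2 *
      (Complex.Gamma (c + t * Complex.I) * Complex.Gamma (M - (c + t * Complex.I)))) := by
  have hre : ∀ t : ℝ, ((μ : ℂ) - (c + t * Complex.I)).re = μ - c := by intro t; simp
  refine (integrable_kernel_vertical hα hc hcM hν).bdd_mul (c := 1 / (μ - c)) ?_
    (Eventually.of_forall fun t => ?_)
  · refine Continuous.aestronglyMeasurable (continuous_const.div (by fun_prop) fun t h => ?_)
    have := hre t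
    rw [h] at this
    simp at this
    linarith
  · rw [norm_div, norm_one]
    refine one_div_le_one_div_of_le (by linarith) ?_
    rw [← hre t]
    exact Complex.re_le_norm _

/-! ### The Fox functions of the link -/

namespace LinkParams

variable {S : LinkParams}

lemma foxSeparates_pdf_iff (hα : 0 < S.α) (c : ℝ) :
    FoxSeparates 3 1 S.pdfTop S.pdfBot c ↔
      0 < c ∧ 0 < S.β - S.α * S.μ + S.α * c ∧ c < S.μ + S.m := by
  have key : ∀ k : ℕ, 0 < S.β - S.α * S.μ + S.α * c →
      -(S.β - S.α * S.μ + (k : ℝ)) / S.α < c := by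
    intro k h
    rw [div_lt_iff₀ hα]
    nlinarith [Nat.cast_nonneg (α := ℝ) k]
  constructor
  · rintro ⟨h1, h2⟩
    have a1 := h1 0 (by norm_num) 0
    have a2 := h1 1 (by norm_num) 0
    have a3 := h2 0 (by norm_num) 0
    simp [pdfBot, pdfTop] at a1 a2 a3
    rw [div_lt_iff₀ hα] at a2
    exact ⟨a1, by nlinarith, by linarith⟩
  · rintro ⟨h1, h2, h3⟩
    refine ⟨fun j hj k => ?_, fun j hj k => ?_⟩
    · fin_cases j
      · simp [pdfBot]
        linarith [Nat.cast_nonneg (α := ℝ) k]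
      · simpa [pdfBot] using key k h2
      · simpa [pdfBot] using key k h2
    · have hj : j = 0 := by ext; simpa using hj
      subst hj
      simp [pdfTop]
      linarith [Nat.cast_nonneg (α := ℝ) k]

lemma foxSeparates_cdf_iff (hα : 0 < S.α) (hm : 0 < S.m) (c : ℝ) :
    FoxSeparates 3 2 S.cdfTop S.cdfBot c ↔
      0 < c ∧ 0 < S.β - S.α * S.μ + S.α * c ∧ c < S.μ := by
  have key : ∀ k : ℕ, 0 < S.β - S.α * S.μ + S.α * c →
      -(S.β - S.α * S.μ + (k : ℝ)) / S.α < c := by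
    intro k h
    rw [div_lt_iff₀ hα]
    nlinarith [Nat.cast_nonneg (α := ℝ) k]
  constructor
  · rintro ⟨h1, h2⟩
    have a1 := h1 0 (by norm_num) 0
    have a2 := h1 1 (by norm_num) 0
    have a3 := h2 1 (by norm_num) 0
    simp [cdfBot, cdfTop] at a1 a2 a3
    rw [div_lt_iff₀ hα] at a2
    exact ⟨a1, by nlinarith, by linarith⟩
  · rintro ⟨h1, h2, h3⟩
    refine ⟨fun j hj k => ?_, fun j hj k => ?_⟩
    · fin_cases j
      · simp [cdfBot]
        linarith [Nat.cast_nonneg (α := ℝ) k]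
      · simpa [cdfBot] using key k h2
      · simpa [cdfBot] using key k h2
      · simp at hj
    · fin_cases j
      · simp [cdfTop]
        linarith [Nat.cast_nonneg (α := ℝ) k]
      · simp [cdfTop]
        linarith [Nat.cast_nonneg (α := ℝ) k]
      · simp at hj
      · simp at hj

/-- An exponent that separates the poles for both kernels. It also serves as the exponent in the bound
`O(y^{-c})`, where `c < μ` is what the integrability over the distance needs. -/
lemma exists_separating (hα : 0 < S.α) (hμ : 0 < S.μ) (hβ : 0 < S.β) :
    ∃ c, 0 < c ∧ 0 < S.β - S.α * S.μ + S.α * c ∧ c < S.μ := by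
  have h : max 0 (S.μ - S.β / S.α) < S.μ := max_lt hμ (by linarith [div_pos hβ hα])
  obtain ⟨c, hc1, hc2⟩ := exists_between h
  refine ⟨c, (le_max_left _ _).trans_lt hc1, ?_, hc2⟩
  have h2 := (le_max_right _ _).trans_lt hc1
  have h3 : S.α * (S.μ - S.β / S.α) < S.α * c := mul_lt_mul_of_pos_left h2 hα
  rw [mul_sub, mul_div_cancel₀ _ hα.ne'] at h3
  linarith

lemma Gamma_mul_inv_Gamma_add_one {w : ℂ} (hw : 0 < w.re) :
    Complex.Gamma w * (Complex.Gamma (1 + w))⁻¹ = 1 / w := by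
  have h0 : w ≠ 0 := by rintro rfl; simp at hw
  have hG : Complex.Gamma w ≠ 0 := Complex.Gamma_ne_zero_of_re_pos hw
  rw [add_comm, Complex.Gamma_add_one w h0]
  field_simp

lemma foxKernel_pdf {s : ℂ} (hν : 0 < S.β - S.α * S.μ + S.α * s.re) :
    foxKernel 3 1 S.pdfTop S.pdfBot s =
      1 / (((S.β - S.α * S.μ : ℝ) : ℂ) + S.α * s) ^ 2 *
        (Complex.Gamma s * Complex.Gamma (((S.μ + S.m : ℝ) : ℂ) - s)) := by
  have h := Gamma_mul_inv_Gamma_add_one (w := ((S.β - S.α * S.μ : ℝ) : ℂ) + S.α * s)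
    (by simpa using hν)
  rw [← one_div_pow, ← h]
  simp only [foxKernel, Fin.prod_univ_three, pdfTop, pdfBot]
  simp
  ring_nf

lemma foxKernel_cdf {s : ℂ} (hν : 0 < S.β - S.α * S.μ + S.α * s.re) (hs : s.re < S.μ) :
    foxKernel 3 2 S.cdfTop S.cdfBot s =
      1 / ((S.μ : ℂ) - s) * (1 / (((S.β - S.α * S.μ : ℝ) : ℂ) + S.α * s) ^ 2 *
        (Complex.Gamma s * Complex.Gamma (((S.μ + S.m : ℝ) : ℂ) - s))) := by
  have h := Gamma_mul_inv_Gamma_add_one (w := ((S.β - S.α * S.μ : ℝ) : ℂ) + S.α * s)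
    (by simpa using hν)
  have h' := Gamma_mul_inv_Gamma_add_one (w := (S.μ : ℂ) - s) (by simpa using hs)
  rw [← one_div_pow, ← h, ← h']
  simp only [foxKernel, Fin.prod_univ_four, cdfTop, cdfBot]
  simp
  ring_nf

variable (S) in
/-- The value of `H^{3,1}_{3,3}`, as a real function. -/
noncomputable def pdfReal : ℝ → ℝ := fadingMix (S.μ + S.m) (S.β - S.α * S.μ) S.α

variable (S) in
/-- The value of `H^{3,2}_{4,4}`, as a real function. -/
noncomputable def cdfReal : ℝ → ℝ := fadingMixCDF (S.μ + S.m) (S.β - S.α * S.μ) S.α S.μ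

lemma hasFoxH_pdf (hα : 0 < S.α) (hμ : 0 < S.μ) (hβ : 0 < S.β) (hm : 0 < S.m) {z : ℝ}
    (hz : 0 < z) : HasFoxH 3 1 S.pdfTop S.pdfBot z (S.pdfReal z) := by
  obtain ⟨c, hc, hν, hcμ⟩ := exists_separating hα hμ hβ
  refine hasFoxH_of_hasMellin ⟨c, (foxSeparates_pdf_iff hα c).2 ⟨hc, hν, by linarith⟩⟩ ?_ ?_ ?_ hz
  · intro c hc t
    obtain ⟨h1, h2, h3⟩ := (foxSeparates_pdf_iff hα c).1 hc
    rw [foxKernel_pdf (by simpa using h2)]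
    exact hasMellin_fadingMix (by simpa using h1) (by simpa using h3) (by simpa using h2)
  · intro c hc
    obtain ⟨h1, h2, h3⟩ := (foxSeparates_pdf_iff hα c).1 hc
    have hk : ∀ t : ℝ, _ = _ := fun t =>
      foxKernel_pdf (S := S) (s := c + t * Complex.I) (by simpa using h2)
    simp only [hk]
    exact integrable_kernel_vertical hα h1 h3 h2
  · exact continuousOn_fadingMix hc.le (by linarith) hν

lemma hasFoxH_cdf (hα : 0 < S.α) (hμ : 0 < S.μ) (hβ : 0 < S.β) (hm : 0 < S.m) {z : ℝ}
    (hz : 0 < z) : HasFoxH 3 2 S.cdfTop S.cdfBot z (S.cdfReal z) := by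
  obtain ⟨c, hc, hν, hcμ⟩ := exists_separating hα hμ hβ
  refine hasFoxH_of_hasMellin ⟨c, (foxSeparates_cdf_iff hα hm c).2 ⟨hc, hν, hcμ⟩⟩ ?_ ?_ ?_ hz
  · intro c hc t
    obtain ⟨h1, h2, h3⟩ := (foxSeparates_cdf_iff hα hm c).1 hc
    rw [foxKernel_cdf (by simpa using h2) (by simpa using h3)]
    exact hasMellin_fadingMixCDF hα (by simpa using h1) (by simpa using (by linarith))
      (by simpa using h2) (by simpa using h3)
  · intro c hc
    obtain ⟨h1, h2, h3⟩ := (foxSeparates_cdf_iff hα hm c).1 hc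
    have hk : ∀ t : ℝ, _ = _ := fun t =>
      foxKernel_cdf (S := S) (s := c + t * Complex.I) (by simpa using h2) (by simpa using h3)
    simp only [hk]
    exact integrable_kernel_vertical_div hα h1 (by linarith) h2 h3
  · exact continuousOn_fadingMixCDF hα hc.le (by linarith) hν hcμ

lemma pdfH_eq (hα : 0 < S.α) (hμ : 0 < S.μ) (hβ : 0 < S.β) (hm : 0 < S.m) {z : ℝ}
    (hz : 0 < z) : S.pdfH z = S.pdfReal z :=
  foxH_eq_of_hasFoxH (hasFoxH_pdf hα hμ hβ hm hz)

lemma cdfH_eq (hα : 0 < S.α) (hμ : 0 < S.μ) (hβ : 0 < S.β) (hm : 0 < S.m) {z : ℝ}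
    (hz : 0 < z) : S.cdfH z = S.cdfReal z :=
  foxH_eq_of_hasFoxH (hasFoxH_cdf hα hμ hβ hm hz)

end LinkParams

/-! ### Lebesgue integrals against densities and scaling -/

lemma lintegral_withDensity_ofReal {f : ℝ → ℝ} (hf : Measurable f) {φ : ℝ → ENNReal}
    (hφ : Measurable φ) :
    ∫⁻ x, φ x ∂(volume.withDensity fun x => ENNReal.ofReal (f x)) =
      ∫⁻ x, ENNReal.ofReal (f x) * φ x := by
  rw [lintegral_withDensity_eq_lintegral_mul _ hf.ennreal_ofReal hφ]
  rfl

lemma lintegral_comp_const_mul {a : ℝ} (ha : 0 < a) {G : ℝ → ENNReal} (hG : Measurable G) :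
    ∫⁻ x, G (a * x) = ENNReal.ofReal a⁻¹ * ∫⁻ x, G x := by
  have h := lintegral_map (μ := volume) hG (measurable_const_mul a)
  rw [Real.map_volume_mul_left ha.ne', lintegral_smul_measure, abs_of_pos (inv_pos.2 ha)] at h
  exact h.symm

/-- The density of `g Z X` for independent `Z > 0` and `X` with densities `fZ` and `fX`. -/
lemma lintegral_lintegral_comp_mul {fZ fX : ℝ → ℝ} (hfZ : Measurable fZ) (hfX : Measurable fX)
    (hZ : ∀ z ≤ 0, fZ z = 0) {g : ℝ} (hg : 0 < g) {φ : ℝ → ENNReal} (hφ : Measurable φ) :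
    ∫⁻ z, ENNReal.ofReal (fZ z) * ∫⁻ x, ENNReal.ofReal (fX x) * φ (g * z * x) =
      ∫⁻ y, φ y * ∫⁻ z, ENNReal.ofReal (fZ z) *
        (ENNReal.ofReal (g * z)⁻¹ * ENNReal.ofReal (fX (y / (g * z)))) := by
  have h1 : ∀ z, ENNReal.ofReal (fZ z) * ∫⁻ x, ENNReal.ofReal (fX x) * φ (g * z * x) =
      ∫⁻ y, φ y * (ENNReal.ofReal (fZ z) *
        (ENNReal.ofReal (g * z)⁻¹ * ENNReal.ofReal (fX (y / (g * z))))) := by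
    intro z
    rcases le_or_gt z 0 with hz | hz
    · simp [hZ z hz]
    · have hgz : 0 < g * z := mul_pos hg hz
      have h2 := lintegral_comp_const_mul hgz
        (G := fun y => ENNReal.ofReal (fX (y / (g * z))) * φ y) (by fun_prop)
      simp only [mul_div_cancel_left₀ _ hgz.ne'] at h2
      rw [h2, ← lintegral_const_mul _ (by fun_prop), ← lintegral_const_mul _ (by fun_prop)]
      congr 1 with y
      ring
  simp only [h1]
  rw [lintegral_lintegral_swap]
  · congr 1 with y
    rw [lintegral_const_mul]
    fun_prop
  · apply Measurable.aemeasurable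
    unfold Function.uncurry
    fun_prop

lemma map_eq_withDensity_of_lintegral {Ω : Type*} [MeasurableSpace Ω] {P : Measure Ω}
    {Y : Ω → ℝ} (hY : Measurable Y) {f : ℝ → ENNReal}
    (h : ∀ φ : ℝ → ENNReal, Measurable φ → ∫⁻ ω, φ (Y ω) ∂P = ∫⁻ y, φ y * f y) :
    P.map Y = volume.withDensity f := by
  ext s hs
  have h1 := h (s.indicator 1) (measurable_one.indicator hs)
  rw [withDensity_apply _ hs, ← lintegral_indicator_one hs,
    lintegral_map (measurable_one.indicator hs) hY, h1, ← lintegral_indicator hs]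
  congr 1 with y
  by_cases hy : y ∈ s <;> simp [hy]

/-- For a triple of independent real variables, integrate successively over the three laws. -/
lemma lintegral_of_iIndepFun {Ω : Type*} [MeasurableSpace Ω] {P : Measure Ω}
    [IsProbabilityMeasure P] {Z X D : Ω → ℝ} (hZ : Measurable Z) (hX : Measurable X)
    (hD : Measurable D) (h : iIndepFun ![Z, X, D] P) {Φ : (ℝ × ℝ) × ℝ → ENNReal}
    (hΦ : Measurable Φ) :
    ∫⁻ ω, Φ ((Z ω, X ω), D ω) ∂P =
      ∫⁻ d, ∫⁻ z, ∫⁻ x, Φ ((z, x), d) ∂(P.map X) ∂(P.map Z) ∂(P.map D) := by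
  have hm : ∀ i, Measurable ((![Z, X, D] : Fin 3 → Ω → ℝ) i) := by
    intro i
    fin_cases i
    · exact hZ
    · exact hX
    · exact hD
  have h1 : IndepFun Z X P := h.indepFun (i := 0) (j := 1) (by decide)
  have h2 : IndepFun (fun ω => (Z ω, X ω)) D P :=
    h.indepFun_prodMk hm 0 1 2 (by decide) (by decide)
  have hZX : Measurable fun ω => (Z ω, X ω) := hZ.prodMk hX
  have := Measure.isProbabilityMeasure_map (μ := P) hZX.aemeasurable
  have := Measure.isProbabilityMeasure_map (μ := P) hX.aemeasurable
  have := Measure.isProbabilityMeasure_map (μ := P) hZ.aemeasurable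
  have := Measure.isProbabilityMeasure_map (μ := P) hD.aemeasurable
  rw [indepFun_iff_map_prod_eq_prod_map_map hZ.aemeasurable hX.aemeasurable] at h1
  rw [indepFun_iff_map_prod_eq_prod_map_map hZX.aemeasurable hD.aemeasurable] at h2
  rw [← lintegral_map (f := Φ) (g := fun ω => ((Z ω, X ω), D ω)) hΦ (hZX.prodMk hD), h2,
    lintegral_prod_symm _ hΦ.aemeasurable]
  congr 1 with d
  rw [h1, lintegral_prod]
  fun_prop

namespace LinkParams

variable {S : LinkParams}

/-! ### The SNR at a fixed distance -/

lemma measurable_misalignPDF : Measurable S.misalignPDF := by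
  unfold misalignPDF
  exact Measurable.ite measurableSet_Ioo (by fun_prop) measurable_const

lemma misalignPDF_of_mem {z : ℝ} (hz : z ∈ Set.Ioo (0 : ℝ) 1) :
    S.misalignPDF z = -(S.β ^ 2 / 4) * Real.log z * z ^ (S.β / 2 - 1) :=
  if_pos hz

lemma misalignPDF_nonneg (z : ℝ) : 0 ≤ S.misalignPDF z := by
  by_cases hz : z ∈ Set.Ioo (0 : ℝ) 1
  · rw [misalignPDF_of_mem hz]
    have hr := Real.rpow_pos_of_pos hz.1 (S.β / 2 - 1)
    have : 0 ≤ -Real.log z := by linarith [Real.log_neg hz.1 hz.2]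
    have : 0 ≤ S.β ^ 2 / 4 * -Real.log z * z ^ (S.β / 2 - 1) := by positivity
    linarith
  · exact (if_neg hz).ge

lemma measurable_fadingPDF (Ef : ℝ) : Measurable (S.fadingPDF Ef) := by
  unfold fadingPDF
  exact Measurable.ite measurableSet_Ioi (by fun_prop) measurable_const

lemma measurable_distPDF : Measurable S.distPDF := by
  unfold distPDF
  exact Measurable.ite measurableSet_Ioo (by fun_prop) measurable_const

lemma measurable_gain : Measurable S.gain := by
  unfold gain
  fun_prop

lemma gain_pos (hγ₀ : 0 < S.γ₀) {d : ℝ} (hd : 1 < d) : 0 < S.gain d := by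
  have : 0 < (d - 1) ^ (-S.δ) := Real.rpow_pos_of_pos (by linarith) _
  unfold gain
  positivity

/-- The mean misalignment power is `β² / (β + 2)²`, which fixes the mean-power parameter. -/
lemma meanPower_eq (hβ : 0 < S.β) {Ω : Type*} [MeasurableSpace Ω] {P : Measure Ω}
    {Hp : Ω → ℝ} (hHp : Measurable Hp)
    (lawZ : P.map (fun ω => Hp ω ^ 2) =
      volume.withDensity (fun z => ENNReal.ofReal (S.misalignPDF z)))
    {Ef : ℝ} (hnorm : Ef * ∫ ω, Hp ω ^ 2 ∂P = 1) : Ef = ((S.β + 2) / S.β) ^ 2 := by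
  have h1 : ∫ ω, Hp ω ^ 2 ∂P = ∫ z, z ∂(P.map fun ω => Hp ω ^ 2) :=
    (integral_map (f := fun z : ℝ => z) (hHp.pow_const 2).aemeasurable
      measurable_id.aestronglyMeasurable).symm
  have hp : 0 < ((S.β / 2 + 1 : ℝ) : ℂ).re := by
    rw [Complex.ofReal_re]; positivity
  have h2 : ∫ z in Set.Ioo (0 : ℝ) 1, -Real.log z * z ^ (S.β / 2) = 1 / (S.β / 2 + 1) ^ 2 := by
    have h3 := (integrableOn_log_mul_cpow_Ioo hp).2
    have h4 : ∀ z ∈ Set.Ioo (0 : ℝ) 1,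
        ((-Real.log z : ℝ) : ℂ) * (z : ℂ) ^ (((S.β / 2 + 1 : ℝ) : ℂ) - 1) =
          ((-Real.log z * z ^ (S.β / 2) : ℝ) : ℂ) := by
      intro z hz
      rw [Complex.ofReal_mul (-Real.log z), Complex.ofReal_cpow hz.1.le]
      push_cast
      ring_nf
    rw [setIntegral_congr_fun measurableSet_Ioo h4, integral_complex_ofReal] at h3
    exact_mod_cast h3
  have h5 : ∫ ω, Hp ω ^ 2 ∂P = S.β ^ 2 / 4 * (1 / (S.β / 2 + 1) ^ 2) := by
    rw [h1, lawZ, integral_withDensity_eq_integral_toReal_smul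
      measurable_misalignPDF.ennreal_ofReal (by simp), ← h2, ← integral_const_mul,
      ← integral_indicator measurableSet_Ioo]
    congr 1 with z
    by_cases hz : z ∈ Set.Ioo (0 : ℝ) 1
    · rw [Set.indicator_of_mem hz, ENNReal.toReal_ofReal (misalignPDF_nonneg z),
        misalignPDF_of_mem hz,
        Real.rpow_sub_one hz.1.ne', smul_eq_mul]
      have := hz.1.ne'
      field_simp
    · rw [Set.indicator_of_notMem hz, show S.misalignPDF z = 0 from if_neg hz]
      simp
  rw [h5] at hnorm
  field_simp at hnorm ⊢
  nlinarith

variable (S) in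
/-- The density at `γ` of `g Z X`, where `Z` is the misalignment power and `X` the fading power. -/
noncomputable def scaledPDF (g γ : ℝ) : ℝ :=
  if 0 < γ then
    4 * S.c₁ * S.c₂ ^ (-(S.μ + S.m)) / Real.Gamma (S.μ + S.m) * γ ^ (S.α * S.μ / 2 - 1) *
      g ^ (-(S.α * S.μ / 2)) * S.pdfReal ((γ / g) ^ (S.α / 2) / S.c₂)
  else 0

variable (S) in
/-- The distribution function at `γ > 0` of `g Z X`. -/
noncomputable def scaledCDF (g γ : ℝ) : ℝ :=
  8 * S.c₁ * S.c₂ ^ (-(S.μ + S.m)) / (S.α * Real.Gamma (S.μ + S.m)) *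
    (γ / g) ^ (S.α * S.μ / 2) * S.cdfReal ((γ / g) ^ (S.α / 2) / S.c₂)

lemma measurable_pdfReal : Measurable S.pdfReal := measurable_fadingMix

lemma measurable_scaledPDF : Measurable (Function.uncurry S.scaledPDF) := by
  unfold scaledPDF Function.uncurry
  refine Measurable.ite (measurableSet_lt measurable_const measurable_snd) ?_ measurable_const
  have h : Measurable fun p : ℝ × ℝ => S.pdfReal ((p.2 / p.1) ^ (S.α / 2) / S.c₂) :=
    measurable_pdfReal.comp (by fun_prop)
  exact Measurable.mul (by fun_prop) h

lemma c₂_pos (hm : 1 < S.m) (hβ : 0 < S.β) (hlam : 0 < S.lam) (hμ : 0 < S.μ) : 0 < S.c₂ := by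
  have : 0 < S.m - 1 := by linarith
  unfold c₂
  positivity

lemma c₁_eq : S.c₁ = S.β ^ 2 * S.α / (8 * beta S.μ S.m) * S.c₂ ^ S.m := by
  unfold c₁ c₂
  congr 3
  ring

lemma c₁_pos (hα : 0 < S.α) (hm : 1 < S.m) (hβ : 0 < S.β) (hlam : 0 < S.lam) (hμ : 0 < S.μ) :
    0 < S.c₁ := by
  have h2 := c₂_pos hm hβ hlam hμ
  have := beta_pos hμ (by linarith : 0 < S.m)
  rw [c₁_eq]
  positivity

lemma fadingPDF_eq (hβ : 0 < S.β) {x : ℝ} (hx : 0 < x) :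
    S.fadingPDF (((S.β + 2) / S.β) ^ 2) x = S.α / (2 * beta S.μ S.m) * S.c₂ ^ S.m *
      x ^ (S.α * S.μ / 2 - 1) * (x ^ (S.α / 2) + S.c₂) ^ (-(S.m + S.μ)) := by
  have h : (S.m - 1) * (((S.β + 2) / S.β) ^ 2) ^ (S.α / 2) / (S.lam ^ (S.α / 2) * S.μ) = S.c₂ := by
    rw [← Real.rpow_natCast, ← Real.rpow_mul (by positivity), c₂,
      Nat.cast_ofNat, mul_div_cancel₀ _ (two_ne_zero), Real.div_rpow (by positivity) hβ.le]
    field_simp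
  rw [fadingPDF, if_pos hx, h]

/-- The integrand of the multiplicative convolution of the two power densities. -/
lemma misalignPDF_mul_fadingPDF (hm : 1 < S.m) (hβ : 0 < S.β)
    (hlam : 0 < S.lam) (hμ : 0 < S.μ) {g γ z : ℝ} (hg : 0 < g) (hγ : 0 < γ)
    (hz : z ∈ Set.Ioo (0 : ℝ) 1) :
    S.misalignPDF z * ((g * z)⁻¹ * S.fadingPDF (((S.β + 2) / S.β) ^ 2) (γ / (g * z))) =
      4 * S.c₁ * S.c₂ ^ (-(S.μ + S.m)) / Real.Gamma (S.μ + S.m) * γ ^ (S.α * S.μ / 2 - 1) *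
        g ^ (-(S.α * S.μ / 2)) * ((-Real.log z * z ^ ((S.β - S.α * S.μ) / 2 - 1) / 4) *
          (Real.Gamma (S.μ + S.m) *
            (1 + z ^ (-(S.α / 2)) * ((γ / g) ^ (S.α / 2) / S.c₂)) ^ (-(S.μ + S.m)))) := by
  have hz0 := hz.1
  have hc2 := c₂_pos hm hβ hlam hμ
  have hG : Real.Gamma (S.μ + S.m) ≠ 0 := (Real.Gamma_pos_of_pos (by linarith)).ne'
  have hr : 0 < γ / g := div_pos hγ hg
  rw [misalignPDF_of_mem hz, fadingPDF_eq hβ (by positivity), c₁_eq, ← div_div γ,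
    Real.div_rpow hr.le hz0.le, Real.div_rpow hr.le hz0.le]
  have e1 : (γ / g) ^ (S.α / 2) / z ^ (S.α / 2) + S.c₂ =
      S.c₂ * (1 + z ^ (-(S.α / 2)) * ((γ / g) ^ (S.α / 2) / S.c₂)) := by
    rw [Real.rpow_neg hz0.le]
    field_simp
    ring
  have hpos : 0 < 1 + z ^ (-(S.α / 2)) * ((γ / g) ^ (S.α / 2) / S.c₂) := by positivity
  rw [e1, Real.mul_rpow hc2.le hpos.le, add_comm S.m S.μ]
  have e2 : (γ / g) ^ (S.α * S.μ / 2 - 1) * g⁻¹ =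
      γ ^ (S.α * S.μ / 2 - 1) * g ^ (-(S.α * S.μ / 2)) := by
    rw [Real.div_rpow hγ.le hg.le, Real.rpow_sub_one hg.ne', Real.rpow_neg hg.le]
    field_simp
  have e3 : z ^ (S.β / 2 - 1) * z⁻¹ * (z ^ (S.α * S.μ / 2 - 1))⁻¹ =
      z ^ ((S.β - S.α * S.μ) / 2 - 1) := by
    rw [← Real.rpow_neg hz0.le, ← Real.rpow_neg_one, ← Real.rpow_add hz0, ← Real.rpow_add hz0]
    congr 1
    ring
  rw [← e3, mul_inv]
  calc _ = -(S.β ^ 2 / 4) * Real.log z * (z ^ (S.β / 2 - 1) * z⁻¹ *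
        (z ^ (S.α * S.μ / 2 - 1))⁻¹) * ((γ / g) ^ (S.α * S.μ / 2 - 1) * g⁻¹) *
        (S.α / (2 * beta S.μ S.m) * S.c₂ ^ S.m) *
        (S.c₂ ^ (-(S.μ + S.m)) *
          (1 + z ^ (-(S.α / 2)) * ((γ / g) ^ (S.α / 2) / S.c₂)) ^ (-(S.μ + S.m))) := by ring
    _ = _ := by
      rw [e2]
      field_simp
      ring

lemma lintegral_misalignPDF_mul_fadingPDF (hα : 0 < S.α) (hm : 1 < S.m) (hβ : 0 < S.β)
    (hlam : 0 < S.lam) (hμ : 0 < S.μ) {g : ℝ} (hg : 0 < g) (γ : ℝ) :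
    ∫⁻ z, ENNReal.ofReal (S.misalignPDF z) * (ENNReal.ofReal (g * z)⁻¹ *
      ENNReal.ofReal (S.fadingPDF (((S.β + 2) / S.β) ^ 2) (γ / (g * z)))) =
        ENNReal.ofReal (S.scaledPDF g γ) := by
  have hsupp : ∀ z ∉ Set.Ioo (0 : ℝ) 1, S.misalignPDF z = 0 := fun z hz => if_neg hz
  rcases le_or_gt γ 0 with hγ | hγ
  · rw [scaledPDF, if_neg (not_lt.2 hγ), ENNReal.ofReal_zero]
    rw [lintegral_congr (g := fun _ => 0), lintegral_zero]
    intro z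
    by_cases hz : z ∈ Set.Ioo (0 : ℝ) 1
    · have : ¬ 0 < γ / (g * z) := not_lt.2 (div_nonpos_of_nonpos_of_nonneg hγ
        (mul_pos hg hz.1).le)
      simp [fadingPDF, this]
    · simp [hsupp z hz]
  · obtain ⟨c, hc, hν, hcμ⟩ := exists_separating hα hμ hβ
    have hc2 := c₂_pos hm hβ hlam hμ
    have hc1 := c₁_pos hα hm hβ hlam hμ
    have hG := Real.Gamma_pos_of_pos (by linarith : 0 < S.μ + S.m)
    have hy : 0 < (γ / g) ^ (S.α / 2) / S.c₂ := by positivity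
    have hint := integrableOn_fadingMix (M := S.μ + S.m) hc.le (by linarith) hν hy
    rw [scaledPDF, if_pos hγ, pdfReal, fadingMix, dilationMix, ← integral_const_mul,
      ofReal_integral_eq_lintegral_ofReal (hint.const_mul _), ← lintegral_indicator
      measurableSet_Ioo]
    · congr 1 with z
      by_cases hz : z ∈ Set.Ioo (0 : ℝ) 1
      · rw [Set.indicator_of_mem hz, ← misalignPDF_mul_fadingPDF hm hβ hlam hμ hg hγ hz,
          ENNReal.ofReal_mul (misalignPDF_nonneg z), ENNReal.ofReal_mul (inv_pos.2 (mul_pos hg hz.1)).le]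
      · rw [Set.indicator_of_notMem hz, hsupp z hz]
        simp
    · refine (ae_restrict_iff' measurableSet_Ioo).2 (Eventually.of_forall fun z hz => ?_)
      have hl := Real.log_neg hz.1 hz.2
      have h3 := rpow_pos_Ioo ((S.β - S.α * S.μ) / 2 - 1) z hz
      have h4 := rpow_pos_Ioo (-(S.α / 2)) z hz
      have h5 : 0 ≤ -Real.log z := by linarith
      simp only [Pi.zero_apply]
      positivity

lemma scaledPDF_nonneg (hα : 0 < S.α) (hm : 1 < S.m) (hβ : 0 < S.β)
    (hlam : 0 < S.lam) (hμ : 0 < S.μ) {g : ℝ} (hg : 0 < g) (γ : ℝ) : 0 ≤ S.scaledPDF g γ := by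
  unfold scaledPDF
  split_ifs with hγ
  · have hc2 := c₂_pos hm hβ hlam hμ
    have hc1 := c₁_pos hα hm hβ hlam hμ
    have hM : 0 < S.μ + S.m := by linarith
    have hG := Real.Gamma_pos_of_pos hM
    have hy : 0 < (γ / g) ^ (S.α / 2) / S.c₂ := by positivity
    have := fadingMix_nonneg (ν := S.β - S.α * S.μ) (α := S.α) hM hy
    unfold pdfReal
    positivity
  · exact le_rfl

lemma scaledCDF_nonneg (hα : 0 < S.α) (hm : 1 < S.m) (hβ : 0 < S.β)
    (hlam : 0 < S.lam) (hμ : 0 < S.μ) {g : ℝ} (hg : 0 < g) {γ : ℝ} (hγ : 0 < γ) :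
    0 ≤ S.scaledCDF g γ := by
  have hc2 := c₂_pos hm hβ hlam hμ
  have hc1 := c₁_pos hα hm hβ hlam hμ
  have hM : 0 < S.μ + S.m := by linarith
  have hG := Real.Gamma_pos_of_pos hM
  have hy : 0 < (γ / g) ^ (S.α / 2) / S.c₂ := by positivity
  have := fadingMixCDF_nonneg (ν := S.β - S.α * S.μ) (μ := S.μ) hα hM hy
  unfold scaledCDF cdfReal
  positivity

/-- Substituting `γ v` for the integration variable gives the representation of `H^{3,2}_{4,4}` as
an average of dilates of `H^{3,1}_{3,3}`. -/
lemma lintegral_Iic_scaledPDF (hα : 0 < S.α) (hm : 1 < S.m) (hβ : 0 < S.β)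
    (hlam : 0 < S.lam) (hμ : 0 < S.μ) {g : ℝ} (hg : 0 < g) {γ : ℝ} (hγ : 0 < γ) :
    ∫⁻ y, (Set.Iic γ).indicator 1 y * ENNReal.ofReal (S.scaledPDF g y) =
      ENNReal.ofReal (S.scaledCDF g γ) := by
  obtain ⟨c, hc, hν, hcμ⟩ := exists_separating hα hμ hβ
  have hc2 := c₂_pos hm hβ hlam hμ
  have hc1 := c₁_pos hα hm hβ hlam hμ
  have hM : 0 < S.μ + S.m := by linarith
  have hG := Real.Gamma_pos_of_pos hM
  have hy : 0 < (γ / g) ^ (S.α / 2) / S.c₂ := by positivity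
  have hmeas : Measurable fun y => (Set.Iic γ).indicator (1 : ℝ → ENNReal) y *
      ENNReal.ofReal (S.scaledPDF g y) :=
    (measurable_one.indicator measurableSet_Iic).mul
      (measurable_scaledPDF.comp measurable_prodMk_left).ennreal_ofReal
  have hsc := lintegral_comp_const_mul hγ hmeas
  have hint := integrableOn_fadingMixCDF hα hc.le (by linarith : c < S.μ + S.m) hν hcμ hy
  set k := 8 * S.c₁ * S.c₂ ^ (-(S.μ + S.m)) / (S.α * Real.Gamma (S.μ + S.m)) *
    (γ / g) ^ (S.α * S.μ / 2) with hk
  have hk0 : 0 < k := by positivity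
  have hpt : ∀ v ∈ Set.Ioo (0 : ℝ) 1, γ * S.scaledPDF g (γ * v) =
      k * (S.α / 2 * v ^ (S.α * S.μ / 2 - 1) *
        S.pdfReal (v ^ (S.α / 2) * ((γ / g) ^ (S.α / 2) / S.c₂))) := by
    intro v hv
    have hv0 := hv.1
    have e1 : (γ * v / g) ^ (S.α / 2) / S.c₂ = v ^ (S.α / 2) * ((γ / g) ^ (S.α / 2) / S.c₂) := by
      rw [mul_div_right_comm, Real.mul_rpow (by positivity) hv0.le]
      ring
    rw [scaledPDF, if_pos (mul_pos hγ hv0), e1, hk, Real.mul_rpow hγ.le hv0.le,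
      Real.div_rpow hγ.le hg.le (S.α * S.μ / 2), Real.rpow_sub_one hγ.ne', Real.rpow_neg hg.le]
    field_simp
    ring
  have hval : ∫⁻ v, (Set.Iic γ).indicator 1 (γ * v) * ENNReal.ofReal (S.scaledPDF g (γ * v)) =
      ENNReal.ofReal (γ⁻¹ * S.scaledCDF g γ) := by
    have hrep : γ⁻¹ * S.scaledCDF g γ = ∫ v in Set.Ioo (0 : ℝ) 1, S.scaledPDF g (γ * v) := by
      rw [scaledCDF, ← hk, cdfReal, fadingMixCDF, dilationMix, ← integral_const_mul,
        ← integral_const_mul]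
      refine setIntegral_congr_fun measurableSet_Ioo fun v hv => ?_
      have := hpt v hv
      simp only [pdfReal] at this
      simp only [← this]
      field_simp
    have hint' : IntegrableOn (fun v => S.scaledPDF g (γ * v)) (Set.Ioo 0 1) := by
      refine IntegrableOn.congr_fun (hint.const_mul (γ⁻¹ * k)) (fun v hv => ?_) measurableSet_Ioo
      have := hpt v hv
      simp only [pdfReal] at this
      simp only [mul_assoc γ⁻¹, ← this]
      field_simp
    rw [hrep, ofReal_integral_eq_lintegral_ofReal hint'
      (Eventually.of_forall fun v => scaledPDF_nonneg hα hm hβ hlam hμ hg _),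
      restrict_Ioo_eq_restrict_Ioc, ← lintegral_indicator measurableSet_Ioc]
    congr 1 with v
    by_cases h0 : 0 < v
    · by_cases h1 : v ≤ 1
      · have : γ * v ≤ γ := by nlinarith
        simp [h0, h1, this]
      · have : ¬ γ * v ≤ γ := by
          push Not at h1 ⊢
          nlinarith
        simp [h0, h1, this]
    · have : ¬ 0 < γ * v := fun h => h0 (pos_of_mul_pos_right h hγ.le)
      simp [h0, scaledPDF, this]
  rw [hval, ENNReal.ofReal_mul (inv_pos.2 hγ).le] at hsc
  have hne : ENNReal.ofReal γ⁻¹ ≠ 0 := by simpa using hγ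
  exact ((ENNReal.mul_right_inj hne ENNReal.ofReal_ne_top).1 hsc).symm

/-- The law of `g Z X` for independent misalignment power `Z` and fading power `X`. -/
lemma lintegral_powers (hα : 0 < S.α) (hm : 1 < S.m) (hβ : 0 < S.β)
    (hlam : 0 < S.lam) (hμ : 0 < S.μ) {g : ℝ} (hg : 0 < g) {φ : ℝ → ENNReal}
    (hφ : Measurable φ) :
    ∫⁻ z, ∫⁻ x, φ (g * z * x)
        ∂(volume.withDensity fun x => ENNReal.ofReal (S.fadingPDF (((S.β + 2) / S.β) ^ 2) x))
        ∂(volume.withDensity fun z => ENNReal.ofReal (S.misalignPDF z)) =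
      ∫⁻ y, φ y * ENNReal.ofReal (S.scaledPDF g y) := by
  have hmX := measurable_fadingPDF (S := S) (((S.β + 2) / S.β) ^ 2)
  have hin : ∀ z, ∫⁻ x, φ (g * z * x)
      ∂(volume.withDensity fun x => ENNReal.ofReal (S.fadingPDF (((S.β + 2) / S.β) ^ 2) x)) =
      ∫⁻ x, ENNReal.ofReal (S.fadingPDF (((S.β + 2) / S.β) ^ 2) x) * φ (g * z * x) := fun z =>
    lintegral_withDensity_ofReal hmX (hφ.comp (measurable_const_mul (g * z)))
  simp only [hin]
  have hmeas : Measurable fun z => ∫⁻ x,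
      ENNReal.ofReal (S.fadingPDF (((S.β + 2) / S.β) ^ 2) x) * φ (g * z * x) := by
    apply Measurable.lintegral_prod_right
    unfold Function.uncurry
    fun_prop
  rw [lintegral_withDensity_ofReal measurable_misalignPDF hmeas,
    lintegral_lintegral_comp_mul measurable_misalignPDF hmX
      (fun z hz => if_neg fun h => absurd h.1 (not_lt.2 hz)) hg hφ]
  simp only [lintegral_misalignPDF_mul_fadingPDF hα hm hβ hlam hμ hg]

/-! ### Averaging over the distance -/

lemma gain_one_add (u : ℝ) :
    S.gain (1 + u) = S.γ₀ * u ^ (-S.δ) * Real.exp (-S.κ * S.d₀ * (1 + u)) := by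
  simp [gain]

lemma div_gain_rpow (hγ₀ : 0 < S.γ₀) {γ u : ℝ} (hγ : 0 < γ) (hu : 0 < u) (e : ℝ) :
    (γ / S.gain (1 + u)) ^ e =
      (γ / S.γ₀) ^ e * (u ^ (e * S.δ) * Real.exp (e * S.κ * S.d₀ * (u + 1))) := by
  have h : γ / S.gain (1 + u) =
      γ / S.γ₀ * (u ^ S.δ * Real.exp (S.κ * S.d₀ * (u + 1))) := by
    have h1 : -S.κ * S.d₀ * (1 + u) = -(S.κ * S.d₀ * (u + 1)) := by ring
    rw [gain_one_add, Real.rpow_neg hu.le, h1, Real.exp_neg]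
    field_simp
  rw [h, Real.mul_rpow (by positivity) (by positivity), Real.mul_rpow (by positivity)
    (by positivity), ← Real.rpow_mul hu.le, ← Real.exp_mul]
  ring_nf

lemma Phi_v₁ (i : Fin S.l) (x : ℝ) : Phi x (S.v₁ i) =
    (S.RM / (2 * S.d₀) * (x + 1)) ^ (S.b i + S.α * S.μ * S.δ / 2) *
      Real.exp (S.α / 2 * S.κ * S.μ * S.d₀ * (S.RM / (2 * S.d₀) * (x + 1) + 1)) := rfl

lemma Phi_v₂ (x : ℝ) : Phi x S.v₂ = (S.RM / (2 * S.d₀) * (x + 1)) ^ (S.α * S.δ / 2) *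
      Real.exp (S.α / 2 * S.κ * S.d₀ * (S.RM / (2 * S.d₀) * (x + 1) + 1)) := rfl

lemma Phi_v₂_pos (hRM : 0 < S.RM) (hd₀ : 0 < S.d₀) {x : ℝ} (hx : -1 < x) :
    0 < Phi x S.v₂ := by
  have : 0 < x + 1 := by linarith
  rw [Phi_v₂]
  positivity

/-- The distance variable is `d = 1 + u` with `u = RM / (2 d₀) (x + 1)`; the first factor on the left is
the Jacobian. -/
lemma scaledPDF_gain (hγ₀ : 0 < S.γ₀) (hRM : 0 < S.RM) (hd₀ : 0 < S.d₀) {γ x : ℝ} (hγ : 0 < γ)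
    (hx : -1 < x) (i : Fin S.l) :
    S.RM / (2 * S.d₀) * (S.RM / (2 * S.d₀) * (x + 1)) ^ S.b i *
        S.scaledPDF (S.gain (1 + S.RM / (2 * S.d₀) * (x + 1))) γ =
      S.pdfFactor γ * (Phi x (S.v₁ i) *
        S.pdfReal (Phi x S.v₂ / S.c₂ * (γ / S.γ₀) ^ (S.α / 2))) := by
  have hx1 : 0 < x + 1 := by linarith
  have hu : 0 < S.RM / (2 * S.d₀) * (x + 1) := by positivity
  rw [scaledPDF, if_pos hγ, Phi_v₁, Phi_v₂]
  set u := S.RM / (2 * S.d₀) * (x + 1) with hu_def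
  have hgain : 0 < S.gain (1 + u) := gain_pos hγ₀ (by linarith)
  have e1 : γ ^ (S.α * S.μ / 2 - 1) * S.gain (1 + u) ^ (-(S.α * S.μ / 2)) =
      (γ / S.gain (1 + u)) ^ (S.α * S.μ / 2) / γ := by
    rw [Real.div_rpow hγ.le hgain.le, Real.rpow_sub_one hγ.ne', Real.rpow_neg hgain.le]
    field_simp
  have e2 : (γ / S.gain (1 + u)) ^ (S.α / 2) / S.c₂ =
      u ^ (S.α * S.δ / 2) * Real.exp (S.α / 2 * S.κ * S.d₀ * (u + 1)) / S.c₂ *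
        (γ / S.γ₀) ^ (S.α / 2) := by
    rw [div_gain_rpow hγ₀ hγ hu, mul_div_right_comm S.α S.δ]
    ring
  have e3 : u ^ (S.b i + S.α * S.μ * S.δ / 2) = u ^ S.b i * u ^ (S.α * S.μ / 2 * S.δ) := by
    rw [← Real.rpow_add hu]
    ring_nf
  have e4 : S.α / 2 * S.κ * S.μ * S.d₀ * (u + 1) = S.α * S.μ / 2 * S.κ * S.d₀ * (u + 1) := by
    ring
  have e5 : (γ / S.γ₀) ^ (S.α * S.μ / 2) / γ = (γ / S.γ₀) ^ (S.α * S.μ / 2 - 1) / S.γ₀ := by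
    rw [Real.rpow_sub_one (div_pos hγ hγ₀).ne']
    field_simp
  rw [mul_assoc (4 * S.c₁ * _ / _), e1, e2, div_gain_rpow hγ₀ hγ hu, e3, e4, pdfFactor,
    mul_div_right_comm _ _ γ, e5]
  field_simp
  ring

lemma scaledCDF_gain (hγ₀ : 0 < S.γ₀) (hRM : 0 < S.RM) (hd₀ : 0 < S.d₀) {γ x : ℝ} (hγ : 0 < γ)
    (hx : -1 < x) (i : Fin S.l) :
    S.RM / (2 * S.d₀) * (S.RM / (2 * S.d₀) * (x + 1)) ^ S.b i *
        S.scaledCDF (S.gain (1 + S.RM / (2 * S.d₀) * (x + 1))) γ =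
      S.cdfFactor γ * (Phi x (S.v₁ i) *
        S.cdfReal (Phi x S.v₂ / S.c₂ * (γ / S.γ₀) ^ (S.α / 2))) := by
  have hx1 : 0 < x + 1 := by linarith
  have hu : 0 < S.RM / (2 * S.d₀) * (x + 1) := by positivity
  rw [scaledCDF, Phi_v₁, Phi_v₂]
  set u := S.RM / (2 * S.d₀) * (x + 1) with hu_def
  have e2 : (γ / S.gain (1 + u)) ^ (S.α / 2) / S.c₂ =
      u ^ (S.α * S.δ / 2) * Real.exp (S.α / 2 * S.κ * S.d₀ * (u + 1)) / S.c₂ *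
        (γ / S.γ₀) ^ (S.α / 2) := by
    rw [div_gain_rpow hγ₀ hγ hu, mul_div_right_comm S.α S.δ]
    ring
  have e3 : u ^ (S.b i + S.α * S.μ * S.δ / 2) = u ^ S.b i * u ^ (S.α * S.μ / 2 * S.δ) := by
    rw [← Real.rpow_add hu]
    ring_nf
  have e4 : S.α / 2 * S.κ * S.μ * S.d₀ * (u + 1) = S.α * S.μ / 2 * S.κ * S.d₀ * (u + 1) := by
    ring
  rw [e2, div_gain_rpow hγ₀ hγ hu, e3, e4, cdfFactor]
  field_simp
  ring

/-- Near `x = -1` the bound `|K y| ≤ C y^{-c}` with `c < μ` is compensated by the first factor, so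
the integrand extends continuously by the value `0`. -/
lemma continuousOn_Phi_mul (hα : 0 < S.α) (hμ : 0 < S.μ) (hδ : 0 < S.δ) (hRM : 0 < S.RM)
    (hd₀ : 0 < S.d₀) (hc2 : 0 < S.c₂) {i : Fin S.l} (hb : 0 ≤ S.b i) {K : ℝ → ℝ}
    (hK : ContinuousOn K (Set.Ioi 0)) {C c : ℝ} (hcμ : c < S.μ)
    (hC : ∀ y > 0, |K y| ≤ C * y ^ (-c)) {t : ℝ} (ht : 0 < t) :
    ContinuousOn (fun x => Phi x (S.v₁ i) * K (Phi x S.v₂ / S.c₂ * t)) (Set.Icc (-1) 1) := by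
  have ha : 0 < S.RM / (2 * S.d₀) := by positivity
  have hp : 0 < S.b i + S.α * S.μ * S.δ / 2 := by positivity
  have hq : 0 < S.α * S.δ / 2 := by positivity
  intro x₀ hx₀
  rcases hx₀.1.lt_or_eq with h | h
  · refine ContinuousAt.continuousWithinAt ?_
    have h1 : 0 < x₀ + 1 := by linarith
    have hbase : S.RM / (2 * S.d₀) * (x₀ + 1) ≠ 0 := by positivity
    have c0 : ContinuousAt (fun x => S.RM / (2 * S.d₀) * (x + 1)) x₀ := by fun_prop
    have c1 : ContinuousAt (fun x => Phi x (S.v₁ i)) x₀ := by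
      simp only [Phi_v₁]
      exact (c0.rpow_const (Or.inl hbase)).mul (by fun_prop)
    have c2 : ContinuousAt (fun x => Phi x S.v₂ / S.c₂ * t) x₀ := by
      simp only [Phi_v₂]
      exact ((((c0.rpow_const (Or.inl hbase)).mul
        (by fun_prop)).div_const _).mul continuousAt_const)
    have hy : 0 < Phi x₀ S.v₂ / S.c₂ * t :=
      mul_pos (div_pos (Phi_v₂_pos hRM hd₀ h) hc2) ht
    exact c1.mul (ContinuousAt.comp (f := fun x => Phi x S.v₂ / S.c₂ * t)
      (hK.continuousAt (Ioi_mem_nhds hy)) c2)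
  · subst h
    have hzero : Phi (-1) (S.v₁ i) = 0 := by
      simp [Phi_v₁, Real.zero_rpow hp.ne']
    rw [ContinuousWithinAt, hzero, zero_mul]
    have he : 0 < S.b i + S.α * S.μ * S.δ / 2 - S.α * S.δ / 2 * c := by
      have : 0 < S.α * S.δ / 2 * (S.μ - c) := mul_pos hq (by linarith)
      nlinarith
    set G : ℝ → ℝ := fun x => C * (t / S.c₂) ^ (-c) *
      ((S.RM / (2 * S.d₀) * (x + 1)) ^ (S.b i + S.α * S.μ * S.δ / 2 - S.α * S.δ / 2 * c) *
      (Real.exp (S.α / 2 * S.κ * S.μ * S.d₀ * (S.RM / (2 * S.d₀) * (x + 1) + 1)) *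
      Real.exp (S.α / 2 * S.κ * S.d₀ * (S.RM / (2 * S.d₀) * (x + 1) + 1)) ^ (-c))) with hG
    have hGc : ContinuousAt G (-1) := by
      refine continuousAt_const.mul (ContinuousAt.mul ?_ (ContinuousAt.mul (by fun_prop) ?_))
      · exact ContinuousAt.rpow_const (by fun_prop) (Or.inr he.le)
      · exact ContinuousAt.rpow_const (by fun_prop) (Or.inl (Real.exp_ne_zero _))
    have hG0 : G (-1) = 0 := by simp [hG, Real.zero_rpow he.ne']
    have hGt : Tendsto G (𝓝[Set.Icc (-1) 1] (-1)) (𝓝 0) := by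
      rw [← hG0]
      exact hGc.tendsto.mono_left nhdsWithin_le_nhds
    refine squeeze_zero_norm' ?_ hGt
    filter_upwards [self_mem_nhdsWithin] with x hx
    rcases hx.1.lt_or_eq with h | h
    · have hu : 0 < S.RM / (2 * S.d₀) * (x + 1) := mul_pos ha (by linarith)
      have hP2 := Phi_v₂_pos hRM hd₀ h
      have hP1 : 0 < Phi x (S.v₁ i) := by
        rw [Phi_v₁]
        positivity
      have hKb := hC (Phi x S.v₂ / S.c₂ * t) (by positivity)
      have e1 : Phi x S.v₂ / S.c₂ * t = Phi x S.v₂ * (t / S.c₂) := by ring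
      rw [norm_mul, Real.norm_of_nonneg hP1.le, Real.norm_eq_abs]
      refine (mul_le_mul_of_nonneg_left hKb hP1.le).trans (le_of_eq ?_)
      rw [e1, Real.mul_rpow hP2.le (by positivity), Phi_v₁, Phi_v₂, Real.mul_rpow (by positivity)
        (Real.exp_pos _).le, ← Real.rpow_mul hu.le]
      simp only [hG]
      rw [sub_eq_add_neg, Real.rpow_add hu (S.b i + S.α * S.μ * S.δ / 2) (-(S.α * S.δ / 2 * c)),
        ← mul_neg]
      ring
    · rw [← h, hzero, hG0, zero_mul, norm_zero]

/-- Rewriting an average over the distance in the variable `x = 2 d₀ (d - 1) / RM - 1`. -/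
lemma lintegral_distPDF_mul (hRM : 0 < S.RM) (hd₀ : 0 < S.d₀) (hB : ∀ d, 0 ≤ S.distPDF d)
    {T : Fin S.l → ℝ → ℝ} (hT : ∀ i, ContinuousOn (T i) (Set.Icc (-1) 1)) {G : ℝ → ℝ}
    (hG : Measurable G) (hG0 : ∀ d > 1, 0 ≤ G d) {F : ℝ}
    (h : ∀ x > -1, ∀ i, S.RM / (2 * S.d₀) * (S.RM / (2 * S.d₀) * (x + 1)) ^ S.b i *
      G (1 + S.RM / (2 * S.d₀) * (x + 1)) = F * T i x) :
    ∫⁻ d, ENNReal.ofReal (S.distPDF d) * ENNReal.ofReal (G d) =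
      ENNReal.ofReal (F * ∑ i, S.B i * (S.d₀ / S.RM) ^ (S.b i + 1) *
        ∫ x in (-1 : ℝ)..1, T i x) ∧
    0 ≤ F * ∑ i, S.B i * (S.d₀ / S.RM) ^ (S.b i + 1) * ∫ x in (-1 : ℝ)..1, T i x := by
  set a := S.RM / (2 * S.d₀) with ha_def
  have ha : 0 < a := by positivity
  have h2a : 1 + S.RM / S.d₀ = 1 + a * 2 := by
    rw [ha_def]
    field_simp
  have hpt : ∀ x ∈ Set.Ioo (-1 : ℝ) 1, a * (S.distPDF (1 + a * (x + 1)) * G (1 + a * (x + 1))) =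
      F * ∑ i, S.B i * (S.d₀ / S.RM) ^ (S.b i + 1) * T i x := by
    intro x hx
    have hin : 1 < 1 + a * (x + 1) ∧ 1 + a * (x + 1) < 1 + S.RM / S.d₀ := by
      rw [h2a]
      constructor <;> nlinarith [hx.1, hx.2]
    rw [distPDF, if_pos hin, add_sub_cancel_left, Finset.mul_sum, Finset.sum_mul, Finset.mul_sum]
    refine Finset.sum_congr rfl fun i _ => ?_
    linear_combination (S.B i * (S.d₀ / S.RM) ^ (S.b i + 1)) * h x hx.1 i
  have hnn : ∀ x ∈ Set.Ioo (-1 : ℝ) 1,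
      0 ≤ F * ∑ i, S.B i * (S.d₀ / S.RM) ^ (S.b i + 1) * T i x := by
    intro x hx
    rw [← hpt x hx]
    exact mul_nonneg ha.le (mul_nonneg (hB _) (hG0 _ (by nlinarith [hx.1])))
  have hTi : ∀ i, IntegrableOn (T i) (Set.Ioo (-1) 1) := fun i =>
    ((hT i).integrableOn_Icc).mono_set Set.Ioo_subset_Icc_self
  have hint : IntegrableOn (fun x => F * ∑ i, S.B i * (S.d₀ / S.RM) ^ (S.b i + 1) * T i x)
      (Set.Ioo (-1) 1) :=
    (integrable_finsetSum _ fun i _ => (hTi i).const_mul _).const_mul _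
  have hval : F * ∑ i, S.B i * (S.d₀ / S.RM) ^ (S.b i + 1) * ∫ x in (-1 : ℝ)..1, T i x =
      ∫ x in Set.Ioo (-1 : ℝ) 1, F * ∑ i, S.B i * (S.d₀ / S.RM) ^ (S.b i + 1) * T i x := by
    rw [integral_const_mul, integral_finsetSum _ fun i _ => (hTi i).const_mul _]
    simp only [integral_const_mul, intervalIntegral.integral_of_le (by norm_num : (-1 : ℝ) ≤ 1),
      integral_Ioc_eq_integral_Ioo]
  refine ⟨?_, hval ▸ setIntegral_nonneg measurableSet_Ioo hnn⟩
  rw [hval, ofReal_integral_eq_lintegral_ofReal hint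
    ((ae_restrict_iff' measurableSet_Ioo).2 (Eventually.of_forall hnn)),
    ← lintegral_indicator measurableSet_Ioo]
  have hm : Measurable fun d => ENNReal.ofReal (S.distPDF d) * ENNReal.ofReal (G d) :=
    measurable_distPDF.ennreal_ofReal.mul hG.ennreal_ofReal
  have hsc := lintegral_comp_const_mul ha
    (G := fun y => ENNReal.ofReal (S.distPDF (1 + a + y)) * ENNReal.ofReal (G (1 + a + y)))
    (hm.comp (measurable_const_add (1 + a)))
  rw [lintegral_add_left_eq_self
    (fun d => ENNReal.ofReal (S.distPDF d) * ENNReal.ofReal (G d)) (1 + a)] at hsc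
  have hscale : ∫⁻ d, ENNReal.ofReal (S.distPDF d) * ENNReal.ofReal (G d) =
      ∫⁻ x, ENNReal.ofReal a * (ENNReal.ofReal (S.distPDF (1 + a + a * x)) *
        ENNReal.ofReal (G (1 + a + a * x))) := by
    have hm2 : Measurable fun x => ENNReal.ofReal (S.distPDF (1 + a + a * x)) *
        ENNReal.ofReal (G (1 + a + a * x)) :=
      hm.comp (by fun_prop : Measurable fun x : ℝ => 1 + a + a * x)
    rw [lintegral_const_mul _ hm2, hsc, ← mul_assoc, ← ENNReal.ofReal_mul ha.le, mul_inv_cancel₀ ha.ne', ENNReal.ofReal_one,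
      one_mul]
  rw [hscale]
  congr 1 with x
  have hx1 : 1 + a + a * x = 1 + a * (x + 1) := by ring
  rw [hx1]
  by_cases hx : x ∈ Set.Ioo (-1 : ℝ) 1
  · rw [Set.indicator_of_mem hx, ← hpt x hx, ENNReal.ofReal_mul ha.le, ENNReal.ofReal_mul (hB _)]
  · have h0 : S.distPDF (1 + a * (x + 1)) = 0 := by
      refine if_neg fun hin => hx ⟨?_, ?_⟩
      · have := pos_of_mul_pos_right (by linarith [hin.1] : 0 < a * (x + 1)) ha.le
        linarith
      · rw [h2a] at hin
        have := lt_of_mul_lt_mul_left (by linarith [hin.2] : a * (x + 1) < a * 2) ha.le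
        linarith
    rw [Set.indicator_of_notMem hx, h0]
    simp

/-! ### Passing from the complex Fox functions to their real representations -/

section Terms

variable {T : Fin S.l → ℝ → ℂ} {R : Fin S.l → ℝ → ℝ}

/-- At `x = -1` the argument of `H` is `0`, where nothing is known about `H`, but the first factor
vanishes there. -/
lemma Phi_mul_eq_ofReal (hα : 0 < S.α) (hμ : 0 < S.μ) (hδ : 0 < S.δ) (hRM : 0 < S.RM)
    (hd₀ : 0 < S.d₀) (hc2 : 0 < S.c₂) {i : Fin S.l} (hb : 0 ≤ S.b i) {H : ℝ → ℂ} {K : ℝ → ℝ}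
    (hH : ∀ z > 0, H z = K z) {t : ℝ} (ht : 0 < t) :
    ∀ x ∈ Set.Icc (-1 : ℝ) 1, (Phi x (S.v₁ i) : ℂ) * H (Phi x S.v₂ / S.c₂ * t) =
      ((Phi x (S.v₁ i) * K (Phi x S.v₂ / S.c₂ * t) : ℝ) : ℂ) := by
  intro x hx
  rcases hx.1.lt_or_eq with h | h
  · rw [hH _ (mul_pos (div_pos (Phi_v₂_pos hRM hd₀ h) hc2) ht), Complex.ofReal_mul]
  · have hp : 0 < S.b i + S.α * S.μ * S.δ / 2 := by positivity
    have hzero : Phi (-1) (S.v₁ i) = 0 := by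
      simp [Phi_v₁, Real.zero_rpow hp.ne']
    rw [← h, hzero]
    simp

lemma intervalIntegrable_of_eq_ofReal {i : Fin S.l}
    (hR : ContinuousOn (R i) (Set.Icc (-1) 1))
    (h : ∀ x ∈ Set.Icc (-1 : ℝ) 1, T i x = (R i x : ℂ)) :
    IntervalIntegrable (T i) volume (-1) 1 := by
  refine ContinuousOn.intervalIntegrable ?_
  rw [Set.uIcc_of_le (by norm_num)]
  exact (Complex.continuous_ofReal.comp_continuousOn hR).congr h

lemma sum_integral_eq_ofReal (h : ∀ i, ∀ x ∈ Set.Icc (-1 : ℝ) 1, T i x = (R i x : ℂ)) (F : ℝ) :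
    (F : ℂ) * ∑ i, ((S.B i * (S.d₀ / S.RM) ^ (S.b i + 1) : ℝ) : ℂ) *
        ∫ x in (-1 : ℝ)..1, T i x =
      ((F * ∑ i, S.B i * (S.d₀ / S.RM) ^ (S.b i + 1) * ∫ x in (-1 : ℝ)..1, R i x : ℝ) : ℂ) := by
  have h1 : ∀ i, ∫ x in (-1 : ℝ)..1, T i x = ((∫ x in (-1 : ℝ)..1, R i x : ℝ) : ℂ) := by
    intro i
    rw [← intervalIntegral.integral_ofReal]
    refine intervalIntegral.integral_congr fun x hx => ?_
    rw [Set.uIcc_of_le (by norm_num)] at hx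
    exact h i x hx
  simp only [h1]
  push_cast
  rfl

lemma tendsto_glSum (hR : ∀ i, ContinuousOn (R i) (Set.Icc (-1) 1))
    (h : ∀ i, ∀ x ∈ Set.Icc (-1 : ℝ) 1, T i x = (R i x : ℂ)) (F : ℝ) :
    Tendsto (fun N => (F : ℂ) * ∑ i, ∑ x ∈ glNodes N,
        ((S.B i * (S.d₀ / S.RM) ^ (S.b i + 1) * glWeight N x : ℝ) : ℂ) * T i x) atTop
      (𝓝 ((F : ℂ) * ∑ i, ((S.B i * (S.d₀ / S.RM) ^ (S.b i + 1) : ℝ) : ℂ) *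
        ∫ x in (-1 : ℝ)..1, T i x)) := by
  have h1 : Tendsto (fun N => F * ∑ i, S.B i * (S.d₀ / S.RM) ^ (S.b i + 1) *
      ∑ x ∈ glNodes N, glWeight N x * R i x) atTop
      (𝓝 (F * ∑ i, S.B i * (S.d₀ / S.RM) ^ (S.b i + 1) * ∫ x in (-1 : ℝ)..1, R i x)) :=
    (tendsto_finsetSum _ fun i _ => (tendsto_glQuadrature (hR i)).const_mul _).const_mul _
  rw [sum_integral_eq_ofReal h]
  refine ((Complex.continuous_ofReal.tendsto _).comp h1).congr fun N => ?_
  simp only [Function.comp_apply, Complex.ofReal_mul, Complex.ofReal_sum]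
  congr 1
  refine Finset.sum_congr rfl fun i _ => ?_
  rw [Finset.mul_sum]
  refine Finset.sum_congr rfl fun x hx => ?_
  rw [h i x (glNodes_subset_Icc hx)]
  ring

end Terms

/-! ### The law of the SNR -/

/-- Successive integration over the three laws: first over the fading and misalignment powers at
fixed distance, then over the distance. -/
lemma lintegral_snr (hα : 0 < S.α) (hm : 1 < S.m) (hβ : 0 < S.β) (hlam : 0 < S.lam)
    (hμ : 0 < S.μ) (hγ₀ : 0 < S.γ₀)
    {Ω : Type*} [MeasurableSpace Ω] {P : Measure Ω} [IsProbabilityMeasure P]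
    {Hp Hf D : Ω → ℝ} (hHp : Measurable Hp) (hHf : Measurable Hf) (hD : Measurable D)
    (hindep : iIndepFun ![fun ω => Hp ω ^ 2, fun ω => Hf ω ^ 2, D] P)
    (lawZ : P.map (fun ω => Hp ω ^ 2) =
      volume.withDensity (fun z => ENNReal.ofReal (S.misalignPDF z)))
    (lawX : P.map (fun ω => Hf ω ^ 2) =
      volume.withDensity (fun x => ENNReal.ofReal (S.fadingPDF (((S.β + 2) / S.β) ^ 2) x)))
    {φ : ℝ → ENNReal} (hφ : Measurable φ) :
    (∀ d > 1, ∫⁻ ω, φ (S.snr d (Hp ω) (Hf ω)) ∂P =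
      ∫⁻ y, φ y * ENNReal.ofReal (S.scaledPDF (S.gain d) y)) ∧
    (P.map D = volume.withDensity (fun d => ENNReal.ofReal (S.distPDF d)) →
      ∫⁻ ω, φ (S.snr (D ω) (Hp ω) (Hf ω)) ∂P = ∫⁻ d, ENNReal.ofReal (S.distPDF d) *
        ∫⁻ y, φ y * ENNReal.ofReal (S.scaledPDF (S.gain d) y)) := by
  have hgain := measurable_gain (S := S)
  constructor
  · intro d hd
    have h := lintegral_of_iIndepFun (hHp.pow_const 2) (hHf.pow_const 2) hD hindep
      (Φ := fun p => φ (S.gain d * p.1.1 * p.1.2)) (by fun_prop)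
    have := Measure.isProbabilityMeasure_map (μ := P) hD.aemeasurable
    simp only [lawZ, lawX, lintegral_powers hα hm hβ hlam hμ (gain_pos hγ₀ hd) hφ,
      lintegral_const, measure_univ, mul_one] at h
    exact h
  · intro lawD
    have h := lintegral_of_iIndepFun (hHp.pow_const 2) (hHf.pow_const 2) hD hindep
      (Φ := fun p => φ (S.gain p.2 * p.1.1 * p.1.2)) (by fun_prop)
    rw [lawD, lintegral_withDensity_eq_lintegral_mul_non_measurable _
      measurable_distPDF.ennreal_ofReal (by simp)] at h
    refine h.trans (lintegral_congr fun d => ?_)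
    rcases le_or_gt d 1 with hd | hd
    · have h0 : S.distPDF d = 0 := if_neg fun h => absurd h.1 (not_lt.2 hd)
      simp [h0]
    · simp only [Pi.mul_apply, lawZ, lawX,
        lintegral_powers hα hm hβ hlam hμ (gain_pos hγ₀ hd) hφ]

lemma measureReal_le_of_lintegral {Ω : Type*} [MeasurableSpace Ω] {P : Measure Ω} {Y : Ω → ℝ}
    (hY : Measurable Y) {γ v : ℝ} (hv : 0 ≤ v)
    (h : ∫⁻ ω, (Set.Iic γ).indicator 1 (Y ω) ∂P = ENNReal.ofReal v) :
    P.real {ω | Y ω ≤ γ} = v := by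
  have h1 : P {ω | Y ω ≤ γ} = ENNReal.ofReal v := by
    rw [← h]
    exact (lintegral_indicator_one (hY measurableSet_Iic)).symm
  rw [measureReal_def, h1, ENNReal.toReal_ofReal hv]

lemma measurable_snr {Ω : Type*} [MeasurableSpace Ω] {Hp Hf D : Ω → ℝ} (hHp : Measurable Hp)
    (hHf : Measurable Hf) (hD : Measurable D) :
    Measurable fun ω => S.snr (D ω) (Hp ω) (Hf ω) := by
  unfold snr
  fun_prop

end LinkParams

open LinkParams in
theorem lemma1 (S : LinkParams)
    (hα : 0 < S.α) (hμ : 0 < S.μ) (hlam : 0 < S.lam) (hm : max (2 / S.α) 1 < S.m)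
    (hβ : 2 < S.β) (hδ : S.δ ∈ Set.Icc (2 : ℝ) 6) (hγ₀ : 0 < S.γ₀) (hd₀ : 0 < S.d₀)
    (hRM : 0 < S.RM) (hb : ∀ i, 0 ≤ S.b i)
    (hB : ∀ d, 0 ≤ S.distPDF d)
    {Ω : Type*} [MeasurableSpace Ω] (P : Measure Ω) [IsProbabilityMeasure P]
    (Hp Hf D : Ω → ℝ) (hHp : Measurable Hp) (hHf : Measurable Hf) (hD : Measurable D)
    (hindep : iIndepFun ![fun ω => Hp ω ^ 2, fun ω => Hf ω ^ 2, D] P)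
    (lawZ : P.map (fun ω => Hp ω ^ 2) =
      volume.withDensity (fun z => ENNReal.ofReal (S.misalignPDF z)))
    (Ef : ℝ) (hEf : 0 < Ef)
    (lawX : P.map (fun ω => Hf ω ^ 2) =
      volume.withDensity (fun x => ENNReal.ofReal (S.fadingPDF Ef x)))
    (lawD : P.map D = volume.withDensity (fun d => ENNReal.ofReal (S.distPDF d)))
    -- normalization of the joint pointing error and fading power
    (hnorm : Ef * ∫ ω, Hp ω ^ 2 ∂P = 1) :
    -- the functions `H^{3,1}_{3,3}` and `H^{3,2}_{4,4}` are well defined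
    (∀ z > 0, HasFoxH 3 1 S.pdfTop S.pdfBot z (S.pdfH z)) ∧
    (∀ z > 0, HasFoxH 3 2 S.cdfTop S.cdfBot z (S.cdfH z)) ∧
    -- exact PDF and CDF at a fixed distance
    (∀ d ∈ Set.Ioo 1 (1 + S.RM / S.d₀),
      HasPDFOnPos (P.map (fun ω => S.snr d (Hp ω) (Hf ω))) (S.condPDF d) ∧
      ∀ γ > 0, (P.real {ω | S.snr d (Hp ω) (Hf ω) ≤ γ} : ℂ) = S.condCDF d γ) ∧
    -- exact PDF and CDF of the SNR under mobility, as distance integrals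
    (∀ γ > 0, ∀ i, IntervalIntegrable (S.pdfTerm i γ) volume (-1) 1 ∧
      IntervalIntegrable (S.cdfTerm i γ) volume (-1) 1) ∧
    HasPDFOnPos (P.map (fun ω => S.snr (D ω) (Hp ω) (Hf ω))) S.pdfIntegral ∧
    (∀ γ > 0, (P.real {ω | S.snr (D ω) (Hp ω) (Hf ω) ≤ γ} : ℂ) = S.cdfIntegral γ) ∧
    -- the double sums are their `N`-point Gauss–Legendre approximations, and converge to them
    (∀ N, (glNodes N).card = N) ∧
    (∀ γ > 0, Tendsto (fun N => S.pdfSum N γ) atTop (𝓝 (S.pdfIntegral γ))) ∧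
    (∀ γ > 0, Tendsto (fun N => S.cdfSum N γ) atTop (𝓝 (S.cdfIntegral γ))) := by
  have hm1 : 1 < S.m := (le_max_right _ _).trans_lt hm
  have hm0 : 0 < S.m := by linarith
  have hβ0 : 0 < S.β := by linarith
  have hδ0 : 0 < S.δ := by linarith [hδ.1]
  have hc2 := c₂_pos hm1 hβ0 hlam hμ
  obtain rfl := meanPower_eq hβ0 hHp lawZ hnorm
  have hpdf : ∀ z > 0, S.pdfH z = S.pdfReal z := fun z hz => pdfH_eq hα hμ hβ0 hm0 hz
  have hcdf : ∀ z > 0, S.cdfH z = S.cdfReal z := fun z hz => cdfH_eq hα hμ hβ0 hm0 hz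
  have hlaw := fun φ (hφ : Measurable φ) =>
    lintegral_snr hα hm1 hβ0 hlam hμ hγ₀ hHp hHf hD hindep lawZ lawX (φ := φ) hφ
  have hind : ∀ γ : ℝ, Measurable ((Set.Iic γ).indicator (1 : ℝ → ENNReal)) := fun γ =>
    measurable_one.indicator measurableSet_Iic
  -- an exponent for the bounds of both Fox functions near `0`
  obtain ⟨c, hc, hν, hcμ⟩ := exists_separating hα hμ hβ0
  -- the real integrands in the rescaled distance, continuous on the closed interval
  set Rp : ℝ → Fin S.l → ℝ → ℝ := fun γ i x =>
    Phi x (S.v₁ i) * S.pdfReal (Phi x S.v₂ / S.c₂ * (γ / S.γ₀) ^ (S.α / 2))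
  set Rc : ℝ → Fin S.l → ℝ → ℝ := fun γ i x =>
    Phi x (S.v₁ i) * S.cdfReal (Phi x S.v₂ / S.c₂ * (γ / S.γ₀) ^ (S.α / 2))
  have ht : ∀ γ > 0, 0 < (γ / S.γ₀) ^ (S.α / 2) := fun γ hγ =>
    Real.rpow_pos_of_pos (div_pos hγ hγ₀) _
  have hRpc : ∀ γ > 0, ∀ i, ContinuousOn (Rp γ i) (Set.Icc (-1) 1) := by
    intro γ hγ i
    obtain ⟨C, -, hC⟩ := exists_abs_fadingMix_le hc.le (by linarith : c < S.μ + S.m) hν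
    exact continuousOn_Phi_mul hα hμ hδ0 hRM hd₀ hc2 (hb i)
      (continuousOn_fadingMix hc.le (by linarith : c < S.μ + S.m) hν) hcμ hC (ht γ hγ)
  have hRcc : ∀ γ > 0, ∀ i, ContinuousOn (Rc γ i) (Set.Icc (-1) 1) := by
    intro γ hγ i
    obtain ⟨C, -, hC⟩ :=
      exists_abs_fadingMixCDF_le hα hc.le (by linarith : c < S.μ + S.m) hν hcμ
    exact continuousOn_Phi_mul hα hμ hδ0 hRM hd₀ hc2 (hb i)
      (continuousOn_fadingMixCDF hα hc.le (by linarith : c < S.μ + S.m) hν hcμ) hcμ hC (ht γ hγ)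
  have hTp : ∀ γ > 0, ∀ i, ∀ x ∈ Set.Icc (-1 : ℝ) 1, S.pdfTerm i γ x = (Rp γ i x : ℂ) :=
    fun γ hγ i => Phi_mul_eq_ofReal hα hμ hδ0 hRM hd₀ hc2 (hb i) hpdf (ht γ hγ)
  have hTc : ∀ γ > 0, ∀ i, ∀ x ∈ Set.Icc (-1 : ℝ) 1, S.cdfTerm i γ x = (Rc γ i x : ℂ) :=
    fun γ hγ i => Phi_mul_eq_ofReal hα hμ hδ0 hRM hd₀ hc2 (hb i) hcdf (ht γ hγ)
  have hmp : ∀ γ, Measurable fun d => S.scaledPDF (S.gain d) γ := fun γ =>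
    measurable_scaledPDF.comp (measurable_gain.prodMk measurable_const)
  have hmc : ∀ γ, Measurable fun d => S.scaledCDF (S.gain d) γ := by
    intro γ
    have hg := measurable_gain (S := S)
    have : Measurable fun d => S.cdfReal ((γ / S.gain d) ^ (S.α / 2) / S.c₂) :=
      measurable_fadingMixCDF.comp (by fun_prop)
    unfold scaledCDF
    exact Measurable.mul (by fun_prop) this
  have havgp := fun γ (hγ : 0 < γ) => lintegral_distPDF_mul hRM hd₀ hB (hRpc γ hγ) (hmp γ)
    (fun d hd => scaledPDF_nonneg hα hm1 hβ0 hlam hμ (gain_pos hγ₀ hd) γ)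
    (fun x hx i => scaledPDF_gain hγ₀ hRM hd₀ hγ hx i)
  have havgc := fun γ (hγ : 0 < γ) => lintegral_distPDF_mul hRM hd₀ hB (hRcc γ hγ) (hmc γ)
    (fun d hd => scaledCDF_nonneg hα hm1 hβ0 hlam hμ (gain_pos hγ₀ hd) hγ)
    (fun x hx i => scaledCDF_gain hγ₀ hRM hd₀ hγ hx i)
  refine ⟨fun z hz => ?_, fun z hz => ?_, fun d hd => ⟨?_, fun γ hγ => ?_⟩, fun γ hγ i => ⟨?_, ?_⟩,
    ?_, fun γ hγ => ?_, card_glNodes, fun γ hγ => ?_, fun γ hγ => ?_⟩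
  · rw [hpdf z hz]
    exact hasFoxH_pdf hα hμ hβ0 hm0 hz
  · rw [hcdf z hz]
    exact hasFoxH_cdf hα hμ hβ0 hm0 hz
  · have hg := gain_pos hγ₀ hd.1
    refine ⟨S.scaledPDF (S.gain d), measurable_scaledPDF.comp measurable_prodMk_left,
      fun γ => scaledPDF_nonneg hα hm1 hβ0 hlam hμ hg γ, fun γ hγ => if_neg (not_lt.2 hγ),
      map_eq_withDensity_of_lintegral (measurable_snr hHp hHf measurable_const)
        fun φ hφ => (hlaw φ hφ).1 d hd.1, fun γ hγ => ?_⟩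
    rw [condPDF, hpdf _ (by positivity), scaledPDF, if_pos hγ, ← Complex.ofReal_mul]
  · have hg := gain_pos hγ₀ hd.1
    rw [measureReal_le_of_lintegral (measurable_snr hHp hHf measurable_const)
      (scaledCDF_nonneg hα hm1 hβ0 hlam hμ hg hγ)
      (((hlaw _ (hind γ)).1 d hd.1).trans
        (lintegral_Iic_scaledPDF hα hm1 hβ0 hlam hμ hg hγ)),
      LinkParams.condCDF, hcdf _ (by positivity), scaledCDF, ← Complex.ofReal_mul]
  · exact intervalIntegrable_of_eq_ofReal (T := fun i => S.pdfTerm i γ) (hRpc γ hγ i) (hTp γ hγ i)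
  · exact intervalIntegrable_of_eq_ofReal (T := fun i => S.cdfTerm i γ) (hRcc γ hγ i) (hTc γ hγ i)
  · -- Tonelli exchanges the averages over the distance and over the SNR
    have hjoint : Measurable fun p : ℝ × ℝ => ENNReal.ofReal (S.distPDF p.1) *
        ENNReal.ofReal (S.scaledPDF (S.gain p.1) p.2) :=
      (measurable_distPDF.comp measurable_fst).ennreal_ofReal.mul
        (measurable_scaledPDF.comp
          ((measurable_gain.comp measurable_fst).prodMk measurable_snd)).ennreal_ofReal
    set f : ℝ → ENNReal := fun γ => ∫⁻ d, ENNReal.ofReal (S.distPDF d) *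
      ENNReal.ofReal (S.scaledPDF (S.gain d) γ) with hf
    have hf0 : ∀ γ ≤ 0, f γ = 0 := by
      intro γ hγ
      simp [hf, scaledPDF, not_lt.2 hγ]
    have hfm : Measurable f := hjoint.lintegral_prod_left'
    have hftop : ∀ γ, f γ ≠ ⊤ := by
      intro γ
      rcases le_or_gt γ 0 with hγ | hγ
      · simp [hf0 γ hγ]
      · simp only [hf, (havgp γ hγ).1]
        exact ENNReal.ofReal_ne_top
    refine ⟨fun γ => (f γ).toReal, hfm.ennreal_toReal, fun γ => ENNReal.toReal_nonneg,
      fun γ hγ => by simp [hf0 γ hγ], ?_, fun γ hγ => ?_⟩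
    · simp only [ENNReal.ofReal_toReal (hftop _)]
      refine map_eq_withDensity_of_lintegral (measurable_snr hHp hHf hD) fun φ hφ => ?_
      rw [(hlaw φ hφ).2 lawD]
      have h1 : ∀ d, ENNReal.ofReal (S.distPDF d) *
          ∫⁻ y, φ y * ENNReal.ofReal (S.scaledPDF (S.gain d) y) =
          ∫⁻ y, φ y * (ENNReal.ofReal (S.distPDF d) *
            ENNReal.ofReal (S.scaledPDF (S.gain d) y)) := by
        intro d
        rw [← lintegral_const_mul]
        · congr 1 with y
          ring
        · exact hφ.mul (measurable_scaledPDF.comp measurable_prodMk_left).ennreal_ofReal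
      simp only [h1]
      rw [lintegral_lintegral_swap ((hφ.comp measurable_snd).mul hjoint).aemeasurable]
      congr 1 with y
      exact lintegral_const_mul _ (hjoint.comp measurable_prodMk_right)
    · simp only [hf]
      rw [(havgp γ hγ).1, ENNReal.toReal_ofReal (havgp γ hγ).2, pdfIntegral,
        sum_integral_eq_ofReal (hTp γ hγ)]
  · have h := (hlaw _ (hind γ)).2 lawD
    have h1 : ∫⁻ d, ENNReal.ofReal (S.distPDF d) *
        ∫⁻ y, (Set.Iic γ).indicator 1 y * ENNReal.ofReal (S.scaledPDF (S.gain d) y) =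
        ∫⁻ d, ENNReal.ofReal (S.distPDF d) * ENNReal.ofReal (S.scaledCDF (S.gain d) γ) := by
      refine lintegral_congr fun d => ?_
      rcases le_or_gt d 1 with hd | hd
      · have h0 : S.distPDF d = 0 := if_neg fun h => absurd h.1 (not_lt.2 hd)
        simp [h0]
      · rw [lintegral_Iic_scaledPDF hα hm1 hβ0 hlam hμ (gain_pos hγ₀ hd) hγ]
    rw [h1, (havgc γ hγ).1] at h
    rw [measureReal_le_of_lintegral (measurable_snr hHp hHf hD) (havgc γ hγ).2 h, cdfIntegral,
      sum_integral_eq_ofReal (hTc γ hγ)]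
  · exact tendsto_glSum (hRpc γ hγ) (hTp γ hγ) _
  · exact tendsto_glSum (hRcc γ hγ) (hTc γ hγ) _
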